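/- Let $N\in\mathbb N$ and $1<p<N$, and let $h:\mathbb R^N\times\mathbb R\to\mathbb R$ be a Carathéodory function, i.e. $h(\cdot,t)$ is measurable for every $t\in\mathbb R$ and $h(x,\cdot)$ is continuous for almost every $x\in\mathbb R^N$. A function $v\in W^{1,p}_{\mathrm{loc}}(\mathbb R^N)$ is called a weak solution of $$-\Delta_p v=h(x,v)\quad\text{in }\mathbb R^N,\qquad \Delta_p v=\operatorname{div}(|\nabla v|^{p-2}\nabla v),$$ if $\int_{\mathbb R^N}|\nabla v|^{p-2}\nabla v\cdot\nabla\varphi\,dx=\int_{\mathbb R^N}h(x,v)\varphi\,dx$ for all $\varphi\in C_c^\infty(\mathbb R^N)$. (i) Let $v\in W^{1,p}(\mathbb R^N)$ be a weak solution, and suppose that there are $M_h\ge 0$ and $a\in L^{N/p}(\mathbb R^N)$ such that $$|h(x,v(x))|\le (M_h+a(x))\,|v(x)|^{p-1}\quad\text{for almost every }x\in\mathbb R^N.$$ Then $v\in L^s(\mathbb R^N)$ for every $s\in[p,\infty)$. (ii) Let $v\in W^{1,p}_{\mathrm{loc}}(\mathbb R^N)$ be a weak solution, and suppose that for every $R>0$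 there are $M\ge 0$ and $a\in L^{N/p}_{\mathrm{loc}}(\mathbb R^N)$ such that $$|h(x,v(x))|\le (M+a(x))\,|v(x)|^{p-1}\quad\text{for almost every }x\in B_R(0).$$ Then $v\in L^s_{\mathrm{loc}}(\mathbb R^N)$ for every $s\in[p,\infty)$. -/

import Mathlib

open MeasureTheory Filter Topology
open scoped ContDiff Gradient

/-- `f ∈ L^q_loc(ℝ^N)`: `f` is in `L^q` on every compact set. -/
def MemLpLoc {N : ℕ} {F : Type*} [NormedAddCommGroup F]
    (f : EuclideanSpace ℝ (Fin N) → F) (q : ENNReal) : Prop :=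
  ∀ K : Set (EuclideanSpace ℝ (Fin N)), IsCompact K → MemLp f q (volume.restrict K)

/-- `G` is the weak (distributional) gradient of `v` on `ℝ^N`: both are locally integrable and
`∫ v ∂ₑφ = -∫ ⟨G, e⟩ φ` for every direction `e` and every `φ ∈ C_c^∞(ℝ^N)`. -/
def HasWeakGradient {N : ℕ} (v : EuclideanSpace ℝ (Fin N) → ℝ)
    (G : EuclideanSpace ℝ (Fin N) → EuclideanSpace ℝ (Fin N)) : Prop :=
  LocallyIntegrable v volume ∧ LocallyIntegrable G volume ∧
    ∀ φ : EuclideanSpace ℝ (Fin N) → ℝ, ContDiff ℝ ∞ φ → HasCompactSupport φ →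
      ∀ e : EuclideanSpace ℝ (Fin N),
        ∫ x, v x * fderiv ℝ φ x e = -∫ x, inner ℝ (G x) e * φ x

/-- `v ∈ W^{1,p}(ℝ^N)`. -/
def MemW1p {N : ℕ} (p : ℝ) (v : EuclideanSpace ℝ (Fin N) → ℝ) : Prop :=
  MemLp v (ENNReal.ofReal p) volume ∧
    ∃ G : EuclideanSpace ℝ (Fin N) → EuclideanSpace ℝ (Fin N),
      HasWeakGradient v G ∧ MemLp G (ENNReal.ofReal p) volume

/-- `v ∈ W^{1,p}_loc(ℝ^N)`. -/
def MemW1pLoc {N : ℕ} (p : ℝ) (v : EuclideanSpace ℝ (Fin N) → ℝ) : Prop :=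
  MemLpLoc v (ENNReal.ofReal p) ∧
    ∃ G : EuclideanSpace ℝ (Fin N) → EuclideanSpace ℝ (Fin N),
      HasWeakGradient v G ∧ MemLpLoc G (ENNReal.ofReal p)

/-- `h : ℝ^N × ℝ → ℝ` is a Carathéodory function: (Lebesgue) measurable in `x` for every `t`,
and continuous in `t` for almost every `x`. -/
def IsCaratheodoryFun {N : ℕ} (h : EuclideanSpace ℝ (Fin N) → ℝ → ℝ) : Prop :=
  (∀ t : ℝ, AEMeasurable (fun x => h x t) volume) ∧
    ∀ᵐ x : EuclideanSpace ℝ (Fin N), Continuous (h x)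

/-- `v` solves `-Δ_p v = h(x, v)` weakly in `ℝ^N`:
`∫ |∇v|^{p-2} ∇v · ∇φ = ∫ h(x, v) φ` for every `φ ∈ C_c^∞(ℝ^N)`, where `∇v` is the weak
gradient of `v` (it is unique up to a null set). -/
def IsWeakSolution {N : ℕ} (p : ℝ) (h : EuclideanSpace ℝ (Fin N) → ℝ → ℝ)
    (v : EuclideanSpace ℝ (Fin N) → ℝ) : Prop :=
  ∃ G : EuclideanSpace ℝ (Fin N) → EuclideanSpace ℝ (Fin N), HasWeakGradient v G ∧
    ∀ φ : EuclideanSpace ℝ (Fin N) → ℝ, ContDiff ℝ ∞ φ → HasCompactSupport φ →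
      ∫ x, ‖G x‖ ^ (p - 2) * inner ℝ (G x) (∇ φ x) = ∫ x, h x (v x) * φ x

/-! The argument is a Brezis–Kato truncation followed by Moser iteration. Let `q` be the Sobolev
exponent, `1/q = 1/p - 1/N`, and let `β ≥ 0`. It suffices to show that `v` in `L^(p(1+β))` implies
`v` in `L^(q(1+β))`: each application multiplies the exponent by `q/p > 1`, and intermediate
exponents follow by interpolation.

For this gain, let `g` be the odd primitive of `min(|t|, L)^β` (`truncPrim L β`) and `ψ` the
primitive of `(g')^p` (`truncPrim L (β * p)`). Both are `C^1` with bounded derivative, so `η^p ψ(v)`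
is an admissible test function. The flux term gives `A = ∫ (η g'(v) |∇v|)^p`. The term carrying `∇η`
is at most `A/2` plus a multiple of `Y = ∫ |g(v) ∇η|^p`, because `|ψ| ≤ |g| (g')^(p-1)`
(`abs_truncPrim_mul_le`). The right-hand side is at most a multiple of `∫ (M + |a|) |η g(v)|^p`,
because `|t| g' ≤ 2^(1+β) |g|` (`abs_mul_truncPow_le`).

The potential `a` is critical: Hölder pairs `L^(N/p)` with `L^(q/p)`, which only reproduces the
Sobolev norm of `η g(v)`. But `|a|` is a bounded function plus a remainder of small `L^(N/p)` norm
(`exists_integral_abs_mul_rpow_le`), so the Sobolev inequality for `η g(v)` lets the critical term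
be absorbed into `A`. This yields `exists_truncated_energy_bound`, with a constant independent of
`L` and `η`. Letting `L → ∞` by Fatou gives `exists_lintegral_cutoff_le`; a fixed cutoff then gives
the local gain, and cutoffs exhausting the space give the global one.

Mollification supplies the calculus of weak gradients: the chain rule, the Sobolev inequality, and
the extension of the weak formulation beyond smooth test functions. The last point needs `h(x, v)`
to lie locally in the dual of `L^q`, which the growth bound gives. -/

/-! ### Mollifiers: `L^q` contraction and convergence. -/

section Mollification

open ContinuousLinearMap
open scoped Convolution ENNReal

/-- A sequence of bump functions at the origin with outer radius `1 / (n + 1)`. -/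
noncomputable def shrinkingBump (E : Type*) [NormedAddCommGroup E] [InnerProductSpace ℝ E]
    (n : ℕ) : ContDiffBump (0 : E) where
  rIn := 1 / ((n : ℝ) + 1) / 2
  rOut := 1 / ((n : ℝ) + 1)
  rIn_pos := by positivity
  rIn_lt_rOut := half_lt_self (by positivity)

lemma shrinkingBump_rOut_le_one {E : Type*} [NormedAddCommGroup E] [InnerProductSpace ℝ E] (n : ℕ) : (shrinkingBump E n).rOut ≤ 1 := by
  change 1 / ((n : ℝ) + 1) ≤ 1
  rw [div_le_one (by positivity)]
  linarith [(Nat.cast_nonneg n : (0 : ℝ) ≤ n)]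

lemma tendsto_shrinkingBump_rOut {E : Type*} [NormedAddCommGroup E] [InnerProductSpace ℝ E] :
    Tendsto (fun n => (shrinkingBump E n).rOut) atTop (𝓝 0) :=
  tendsto_one_div_add_atTop_nhds_zero_nat

variable {E : Type*} [NormedAddCommGroup E] [InnerProductSpace ℝ E] [FiniteDimensional ℝ E]
  [MeasurableSpace E] {F : Type*} [NormedAddCommGroup F] [NormedSpace ℝ F]

/-- Mollification at scale `1 / (n + 1)`. -/
noncomputable def mollify (μ : Measure E) (n : ℕ) (f : E → F) : E → F :=
  (shrinkingBump E n).normed μ ⋆[lsmul ℝ ℝ, μ] f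

lemma mollify_apply {μ : Measure E} (n : ℕ) (f : E → F) (x : E) :
    mollify μ n f x = ∫ t, (shrinkingBump E n).normed μ t • f (x - t) ∂μ := rfl

variable [BorelSpace E] {μ : Measure E} [μ.IsAddHaarMeasure]

lemma mollify_apply_swap (n : ℕ) (f : E → F) (x : E) :
    mollify μ n f x = ∫ t, (shrinkingBump E n).normed μ (x - t) • f t ∂μ := by
  rw [mollify, convolution_eq_swap]; rfl

lemma convolutionExists_shrinkingBump (n : ℕ) {f : E → F} (hf : LocallyIntegrable f μ) :
    ConvolutionExists ((shrinkingBump E n).normed μ) f (lsmul ℝ ℝ) μ :=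
  (shrinkingBump E n).hasCompactSupport_normed.convolutionExists_left _
    (shrinkingBump E n).continuous_normed hf

lemma contDiff_mollify (n : ℕ) {f : E → F} (hf : LocallyIntegrable f μ) :
    ContDiff ℝ ∞ (mollify μ n f) :=
  (shrinkingBump E n).hasCompactSupport_normed.contDiff_convolution_left _
    (shrinkingBump E n).contDiff_normed hf

lemma mollify_sub (n : ℕ) {f g : E → F} (hf : LocallyIntegrable f μ)
    (hg : LocallyIntegrable g μ) :
    mollify μ n (f - g) = mollify μ n f - mollify μ n g := by
  ext x
  simp only [mollify_apply, Pi.sub_apply, smul_sub]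
  exact integral_sub (convolutionExists_shrinkingBump n hf x)
    (convolutionExists_shrinkingBump n hg x)

/-- Jensen's inequality for the probability measure whose density is the bump, in the form that the
`L^1` norm is at most the `L^q` norm. -/
lemma enorm_mollify_rpow_le (n : ℕ) {q : ℝ} (hq : 1 ≤ q) {f : E → F}
    (hf : StronglyMeasurable f) (x : E) :
    ‖mollify μ n f x‖ₑ ^ q ≤
      ∫⁻ t, ENNReal.ofReal ((shrinkingBump E n).normed μ t) * ‖f (x - t)‖ₑ ^ q ∂μ := by
  have hq0 : 0 < q := by linarith
  set ρ := (shrinkingBump E n).normed μ with hρ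
  have hρm : Measurable (fun t => ENNReal.ofReal (ρ t)) :=
    (shrinkingBump E n).continuous_normed.measurable.ennreal_ofReal
  have hprob : IsProbabilityMeasure (μ.withDensity fun t => ENNReal.ofReal (ρ t)) := by
    constructor
    rw [withDensity_apply _ MeasurableSet.univ, Measure.restrict_univ,
      ← ofReal_integral_eq_lintegral_ofReal (shrinkingBump E n).integrable_normed
        (Eventually.of_forall (shrinkingBump E n).nonneg_normed),
      (shrinkingBump E n).integral_normed, ENNReal.ofReal_one]
  have hfm : Measurable fun t => ‖f (x - t)‖ₑ :=
    hf.enorm.comp (measurable_const.sub measurable_id)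
  have h1 : ‖mollify μ n f x‖ₑ ≤
      ∫⁻ t, ‖f (x - t)‖ₑ ∂(μ.withDensity fun t => ENNReal.ofReal (ρ t)) := by
    rw [lintegral_withDensity_eq_lintegral_mul _ hρm hfm, mollify_apply]
    refine (enorm_integral_le_lintegral_enorm _).trans (lintegral_mono fun t => ?_)
    rw [enorm_smul, Real.enorm_of_nonneg ((shrinkingBump E n).nonneg_normed t)]
    rfl
  have h2 := eLpNorm_le_eLpNorm_of_exponent_le (μ := μ.withDensity fun t => ENNReal.ofReal (ρ t))
    (f := fun t => ‖f (x - t)‖ₑ) (p := 1) (q := ENNReal.ofReal q) (by simpa using hq)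
    hfm.aestronglyMeasurable
  rw [eLpNorm_one_eq_lintegral_enorm, eLpNorm_eq_lintegral_rpow_enorm_toReal (by simpa using hq0)
    ENNReal.ofReal_ne_top, ENNReal.toReal_ofReal hq0.le] at h2
  simp only [enorm_eq_self] at h2
  calc _ ≤ ((∫⁻ t, ‖f (x - t)‖ₑ ^ q ∂(μ.withDensity fun t => ENNReal.ofReal (ρ t))) ^ (1 / q)) ^ q
        := ENNReal.rpow_le_rpow (h1.trans h2) hq0.le
    _ = ∫⁻ t, ‖f (x - t)‖ₑ ^ q ∂(μ.withDensity fun t => ENNReal.ofReal (ρ t)) := by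
        rw [← ENNReal.rpow_mul, one_div_mul_cancel hq0.ne', ENNReal.rpow_one]
    _ = _ := by
        rw [lintegral_withDensity_eq_lintegral_mul _ hρm (hfm.pow_const q)]
        rfl

lemma eLpNorm_mollify_le (n : ℕ) {q : ℝ} (hq : 1 ≤ q) {f : E → F}
    (hf : AEStronglyMeasurable f μ) :
    eLpNorm (mollify μ n f) (ENNReal.ofReal q) μ ≤ eLpNorm f (ENNReal.ofReal q) μ := by
  have hq0 : 0 < q := by linarith
  -- A strongly measurable representative makes `(x, t) ↦ g (x - t)` jointly measurable, as Tonelli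
  -- requires below.
  have hcongr : mollify μ n f = mollify μ n (hf.mk f) :=
    convolution_congr _ (EventuallyEq.refl _ _) hf.ae_eq_mk
  rw [hcongr, eLpNorm_congr_ae hf.ae_eq_mk]
  have hg := hf.stronglyMeasurable_mk
  set g := hf.mk f
  rw [eLpNorm_eq_lintegral_rpow_enorm_toReal (by simpa using hq0) ENNReal.ofReal_ne_top,
    eLpNorm_eq_lintegral_rpow_enorm_toReal (by simpa using hq0) ENNReal.ofReal_ne_top,
    ENNReal.toReal_ofReal hq0.le]
  refine ENNReal.rpow_le_rpow ?_ (by positivity)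
  have hρm : Measurable (fun t => ENNReal.ofReal ((shrinkingBump E n).normed μ t)) :=
    (shrinkingBump E n).continuous_normed.measurable.ennreal_ofReal
  calc ∫⁻ x, ‖mollify μ n g x‖ₑ ^ q ∂μ
      ≤ ∫⁻ x, ∫⁻ t, ENNReal.ofReal ((shrinkingBump E n).normed μ t) * ‖g (x - t)‖ₑ ^ q ∂μ ∂μ :=
        lintegral_mono fun x => enorm_mollify_rpow_le n hq hg x
    _ = ∫⁻ t, ∫⁻ x, ENNReal.ofReal ((shrinkingBump E n).normed μ t) * ‖g (x - t)‖ₑ ^ q ∂μ ∂μ := by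
        refine lintegral_lintegral_swap (Measurable.aemeasurable ?_)
        exact (hρm.comp measurable_snd).mul
          ((hg.enorm.comp (measurable_fst.sub measurable_snd)).pow_const q)
    _ = ∫⁻ t, ENNReal.ofReal ((shrinkingBump E n).normed μ t) * ∫⁻ x, ‖g x‖ₑ ^ q ∂μ ∂μ := by
        refine lintegral_congr fun t => ?_
        rw [lintegral_const_mul' _ _ ENNReal.ofReal_ne_top,
          lintegral_sub_right_eq_self (fun x => ‖g x‖ₑ ^ q) t]
    _ = ∫⁻ x, ‖g x‖ₑ ^ q ∂μ := by
        rw [lintegral_mul_const _ hρm,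
          ← ofReal_integral_eq_lintegral_ofReal (shrinkingBump E n).integrable_normed
            (Eventually.of_forall (shrinkingBump E n).nonneg_normed),
          (shrinkingBump E n).integral_normed, ENNReal.ofReal_one, one_mul]

lemma mollify_eq_zero_of_notMem_cthickening (n : ℕ) {f : E → F} {x : E}
    (hx : x ∉ Metric.cthickening 1 (tsupport f)) : mollify μ n f x = 0 := by
  rw [mollify_apply]
  refine integral_eq_zero_of_ae (Eventually.of_forall fun t => ?_)
  by_cases ht : t ∈ Metric.ball (0 : E) (shrinkingBump E n).rOut
  · suffices f (x - t) = 0 by simp [this]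
    refine image_eq_zero_of_notMem_tsupport fun hmem => hx ?_
    refine Metric.mem_cthickening_of_dist_le x (x - t) 1 _ hmem ?_
    have : ‖t‖ < (shrinkingBump E n).rOut := by simpa using ht
    simpa [dist_eq_norm] using this.le.trans (shrinkingBump_rOut_le_one n)
  · rw [← (shrinkingBump E n).support_normed_eq (μ := μ), Function.notMem_support] at ht
    simp [ht]

lemma hasCompactSupport_mollify (n : ℕ) {f : E → F} (hf : HasCompactSupport f) :
    HasCompactSupport (mollify μ n f) :=
  HasCompactSupport.intro hf.cthickening fun _ hx => mollify_eq_zero_of_notMem_cthickening n hx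

/-- All bumps have radius at most `1`, so one thickening serves every `n`. This localises
convergence to compact sets. -/
lemma mollify_congr_of_cthickening (n : ℕ) {f g : E → F} {K : Set E}
    (hfg : Set.EqOn f g (Metric.cthickening 1 K)) :
    Set.EqOn (mollify μ n f) (mollify μ n g) K := by
  intro x hx
  rw [mollify_apply, mollify_apply]
  refine integral_congr_ae (Eventually.of_forall fun t => ?_)
  by_cases ht : t ∈ Metric.ball (0 : E) (shrinkingBump E n).rOut
  · have : x - t ∈ Metric.cthickening 1 K := by
      refine Metric.mem_cthickening_of_dist_le _ x 1 _ hx ?_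
      have : ‖t‖ < (shrinkingBump E n).rOut := by simpa using ht
      simpa [dist_eq_norm] using this.le.trans (shrinkingBump_rOut_le_one n)
    simp [hfg this]
  · rw [← (shrinkingBump E n).support_normed_eq (μ := μ), Function.notMem_support] at ht
    simp [ht]

variable [CompleteSpace F]

lemma ae_tendsto_mollify {f : E → F} (hf : LocallyIntegrable f μ) :
    ∀ᵐ x ∂μ, Tendsto (fun n => mollify μ n f x) atTop (𝓝 (f x)) := by
  -- Lebesgue differentiation needs the ratio of outer to inner radius bounded; here it is exactly
  -- `2`.
  refine ContDiffBump.ae_convolution_tendsto_right_of_locallyIntegrable (K := 2)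
    tendsto_shrinkingBump_rOut (Eventually.of_forall fun n => le_of_eq ?_) hf
  change 1 / ((n : ℝ) + 1) = 2 * (1 / ((n : ℝ) + 1) / 2)
  ring

lemma tendsto_eLpNorm_mollify_sub_of_continuous {q : ℝ} (hq : 1 ≤ q) {g : E → F}
    (hg : Continuous g) (hgs : HasCompactSupport g) :
    Tendsto (fun n => eLpNorm (mollify μ n g - g) (ENNReal.ofReal q) μ) atTop (𝓝 0) := by
  set K := Metric.cthickening 1 (tsupport g) with hK
  have hKc : IsCompact K := hgs.cthickening
  have hsub : ∀ n, Function.support (mollify μ n g - g) ⊆ K := by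
    intro n x hx
    by_contra hxK
    refine hx ?_
    have : g x = 0 := image_eq_zero_of_notMem_tsupport
      fun h => hxK (Metric.self_subset_cthickening _ h)
    simp [mollify_eq_zero_of_notMem_cthickening n hxK, this]
  have hlim : Tendsto (fun ε : ℝ => μ K ^ q⁻¹ * ENNReal.ofReal ε) (𝓝[>] 0) (𝓝 0) := by
    have : Tendsto (fun ε : ℝ => μ K ^ q⁻¹ * ENNReal.ofReal ε) (𝓝 0)
        (𝓝 (μ K ^ q⁻¹ * ENNReal.ofReal 0)) :=
      ENNReal.Tendsto.const_mul (ENNReal.continuous_ofReal.tendsto 0)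
        (Or.inr (ENNReal.rpow_ne_top_of_nonneg (by positivity) hKc.measure_lt_top.ne))
    simp only [ENNReal.ofReal_zero, mul_zero] at this
    exact this.mono_left nhdsWithin_le_nhds
  rw [ENNReal.tendsto_nhds_zero]
  intro δ hδ
  obtain ⟨ε, hε, hεpos⟩ :=
    (((ENNReal.tendsto_nhds_zero.1 hlim) δ hδ).and self_mem_nhdsWithin).exists
  obtain ⟨r, hr, hunif⟩ := Metric.uniformContinuous_iff.1 (hgs.uniformContinuous_of_continuous hg)
    ε hεpos
  have hsmall : ∀ᶠ n in atTop, (shrinkingBump E n).rOut < r :=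
    tendsto_shrinkingBump_rOut.eventually (gt_mem_nhds hr)
  filter_upwards [hsmall] with n hn
  rw [← eLpNorm_restrict_eq_of_support_subset (hsub n)]
  refine (eLpNorm_le_of_ae_bound (C := ε) (Eventually.of_forall fun x => ?_)).trans ?_
  · rw [Pi.sub_apply, ← dist_eq_norm]
    exact ContDiffBump.dist_normed_convolution_le hg.aestronglyMeasurable
      fun y hy => (hunif ((Metric.mem_ball.1 hy).trans hn)).le
  · rw [Measure.restrict_apply_univ, ENNReal.toReal_ofReal (by linarith)]
    exact hε

/-- Density of compactly supported continuous functions, with mollification a contraction: an `ε + ε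
+ ε` argument. -/
lemma tendsto_eLpNorm_mollify_sub {q : ℝ} (hq : 1 ≤ q) {f : E → F}
    (hf : MemLp f (ENNReal.ofReal q) μ) :
    Tendsto (fun n => eLpNorm (mollify μ n f - f) (ENNReal.ofReal q) μ) atTop (𝓝 0) := by
  have hq1 : 1 ≤ ENNReal.ofReal q := by simpa using hq
  rw [ENNReal.tendsto_nhds_zero]
  intro δ hδ
  obtain ⟨ε, hε, hεδ⟩ : ∃ ε : ℝ≥0∞, 0 < ε ∧ ε + ε + ε ≤ δ :=
    ⟨δ / 3, ENNReal.div_pos hδ.ne' (by simp), (ENNReal.add_thirds δ).le⟩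
  obtain ⟨g, hgs, hfg, hgc, hgL⟩ :=
    hf.exists_hasCompactSupport_eLpNorm_sub_le ENNReal.ofReal_ne_top hε.ne'
  have hfl := hf.locallyIntegrable hq1
  have hgl := hgL.locallyIntegrable hq1
  filter_upwards [(ENNReal.tendsto_nhds_zero.1
    (tendsto_eLpNorm_mollify_sub_of_continuous (μ := μ) hq hgc hgs)) ε hε] with n hn
  have hdec : mollify μ n f - f = mollify μ n (f - g) + (mollify μ n g - g) + (g - f) := by
    rw [mollify_sub n hfl hgl]; abel
  have hm1 : AEStronglyMeasurable (mollify μ n (f - g)) μ :=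
    (contDiff_mollify n (hfl.sub hgl)).continuous.aestronglyMeasurable
  have hm2 : AEStronglyMeasurable (mollify μ n g - g) μ :=
    ((contDiff_mollify n hgl).continuous.sub hgc).aestronglyMeasurable
  rw [hdec]
  refine (eLpNorm_add_le (hm1.add hm2) (hgL.1.sub hf.1) hq1).trans (le_trans ?_ hεδ)
  gcongr
  · refine (eLpNorm_add_le hm1 hm2 hq1).trans ?_
    gcongr
    exact (eLpNorm_mollify_le n hq (hf.1.sub hgL.1)).trans hfg
  · rwa [eLpNorm_sub_comm]

lemma tendsto_eLpNorm_mollify_sub_restrict {q : ℝ} (hq : 1 ≤ q) {f : E → F}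
    (hf : ∀ K, IsCompact K → MemLp f (ENNReal.ofReal q) (μ.restrict K)) {K : Set E}
    (hK : IsCompact K) :
    Tendsto (fun n => eLpNorm (mollify μ n f - f) (ENNReal.ofReal q) (μ.restrict K))
      atTop (𝓝 0) := by
  set K' := Metric.cthickening 1 K
  have hK' : IsCompact K' := hK.cthickening
  have hmem : MemLp (K'.indicator f) (ENNReal.ofReal q) μ :=
    (memLp_indicator_iff_restrict hK'.measurableSet).2 (hf K' hK')
  refine tendsto_of_tendsto_of_tendsto_of_le_of_le tendsto_const_nhds
    (tendsto_eLpNorm_mollify_sub hq hmem) (fun n => bot_le) fun n => ?_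
  refine le_trans (le_of_eq ?_) (eLpNorm_mono_measure _ (Measure.restrict_le_self (s := K)))
  refine eLpNorm_congr_ae ?_
  filter_upwards [ae_restrict_mem hK.measurableSet] with x hx
  have h1 : Set.EqOn f (K'.indicator f) K' := fun y hy => (Set.indicator_of_mem hy f).symm
  simp only [Pi.sub_apply]
  rw [mollify_congr_of_cthickening n h1 hx, h1 (Metric.self_subset_cthickening _ hx)]

end Mollification

/-! ### Limits in `L^p` and in the duality pairing. -/

section LpTools

open scoped ENNReal

variable {α : Type*} {m : MeasurableSpace α} {μ : Measure α}

/-- Dominated convergence to zero in `L^p`. -/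
lemma tendsto_eLpNorm_zero_of_dominated {F : Type*} [NormedAddCommGroup F] {p : ℝ} (hp : 0 < p)
    {f : ℕ → α → F} (hf : ∀ n, AEStronglyMeasurable (f n) μ) {b : α → ℝ}
    (hb : MemLp b (ENNReal.ofReal p) μ) (hfb : ∀ n, ∀ᵐ x ∂μ, ‖f n x‖ ≤ b x)
    (hlim : ∀ᵐ x ∂μ, Tendsto (fun n => f n x) atTop (𝓝 0)) :
    Tendsto (fun n => eLpNorm (f n) (ENNReal.ofReal p) μ) atTop (𝓝 0) := by
  have hp0 : ENNReal.ofReal p ≠ 0 := by simpa using hp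
  have hkey : Tendsto (fun n => ∫⁻ x, ‖f n x‖ₑ ^ p ∂μ) atTop (𝓝 (∫⁻ _, 0 ∂μ)) := by
    refine tendsto_lintegral_of_dominated_convergence' (fun x => ‖b x‖ₑ ^ p)
      (fun n => (hf n).enorm.pow_const p) (fun n => ?_) ?_ ?_
    · filter_upwards [hfb n] with x hx
      refine ENNReal.rpow_le_rpow ?_ hp.le
      exact enorm_le_iff_norm_le.2 (hx.trans (le_abs_self _))
    · have := lintegral_rpow_enorm_lt_top_of_eLpNorm_lt_top hp0 ENNReal.ofReal_ne_top hb.2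
      rw [ENNReal.toReal_ofReal hp.le] at this
      exact this.ne
    · filter_upwards [hlim] with x hx
      have h1 : Tendsto (fun n => ‖f n x‖ₑ) atTop (𝓝 0) := by
        have := hx.enorm
        rwa [enorm_zero] at this
      have := h1.ennrpow_const p
      rwa [ENNReal.zero_rpow_of_pos hp] at this
  rw [lintegral_zero] at hkey
  have h2 := hkey.ennrpow_const (1 / p)
  rw [ENNReal.zero_rpow_of_pos (by positivity)] at h2
  refine h2.congr fun n => ?_
  rw [eLpNorm_eq_lintegral_rpow_enorm_toReal hp0 ENNReal.ofReal_ne_top,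
    ENNReal.toReal_ofReal hp.le]

/-- The `L^p`-`L^q` duality pairing is continuous in its second argument. -/
lemma tendsto_integral_inner {V : Type*} [NormedAddCommGroup V] [InnerProductSpace ℝ V]
    {p q : ℝ} (hpq : p.HolderConjugate q) {X : α → V} (hX : MemLp X (ENNReal.ofReal p) μ)
    {Y : ℕ → α → V} {Z : α → V} (hY : ∀ n, MemLp (Y n) (ENNReal.ofReal q) μ)
    (hZ : MemLp Z (ENNReal.ofReal q) μ)
    (hlim : Tendsto (fun n => eLpNorm (Y n - Z) (ENNReal.ofReal q) μ) atTop (𝓝 0)) :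
    Tendsto (fun n => ∫ x, inner ℝ (X x) (Y n x) ∂μ) atTop (𝓝 (∫ x, inner ℝ (X x) (Z x) ∂μ)) := by
  have : (ENNReal.ofReal p).HolderTriple (ENNReal.ofReal q) 1 := hpq.ennrealOfReal
  have hbound : ∀ W : α → V, MemLp W (ENNReal.ofReal q) μ →
      eLpNorm (fun x => inner ℝ (X x) (W x)) 1 μ ≤
        eLpNorm X (ENNReal.ofReal p) μ * eLpNorm W (ENNReal.ofReal q) μ := by
    intro W hW
    have := eLpNorm_le_eLpNorm_mul_eLpNorm'_of_norm (p := ENNReal.ofReal p)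
      (q := ENNReal.ofReal q) (r := 1) hX.1 hW.1 (fun a b => inner ℝ a b) 1
      (Eventually.of_forall fun x => by simpa using norm_inner_le_norm (𝕜 := ℝ) (X x) (W x))
    simpa using this
  have hint : ∀ W : α → V, MemLp W (ENNReal.ofReal q) μ →
      Integrable (fun x => inner ℝ (X x) (W x)) μ := by
    intro W hW
    rw [← memLp_one_iff_integrable]
    exact ⟨hX.1.inner hW.1, (hbound W hW).trans_lt (ENNReal.mul_lt_top hX.2 hW.2)⟩
  refine tendsto_integral_of_L1 _ (hint Z hZ).1 (Eventually.of_forall fun n => hint _ (hY n)) ?_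
  have h0 : Tendsto (fun n => eLpNorm X (ENNReal.ofReal p) μ *
      eLpNorm (Y n - Z) (ENNReal.ofReal q) μ) atTop (𝓝 0) := by
    have := ENNReal.Tendsto.const_mul hlim (Or.inr hX.2.ne)
    rwa [mul_zero] at this
  refine tendsto_of_tendsto_of_tendsto_of_le_of_le tendsto_const_nhds h0 (fun _ => bot_le)
    fun n => ?_
  refine le_trans (le_of_eq ?_) (hbound _ ((hY n).sub hZ))
  rw [eLpNorm_one_eq_lintegral_enorm]
  simp [inner_sub_right]

end LpTools

/-! ### Weak gradients: uniqueness and mollification. -/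

section WeakGradient

open ContinuousLinearMap
open scoped Convolution ENNReal

variable {N : ℕ} {v : EuclideanSpace ℝ (Fin N) → ℝ}
  {G : EuclideanSpace ℝ (Fin N) → EuclideanSpace ℝ (Fin N)}

lemma norm_gradient_eq {E : Type*} [NormedAddCommGroup E] [InnerProductSpace ℝ E]
    [CompleteSpace E] (φ : E → ℝ) (x : E) : ‖∇ φ x‖ = ‖fderiv ℝ φ x‖ := by
  rw [← toDual_gradient, LinearIsometryEquiv.norm_map]

lemma continuous_gradient {E : Type*} [NormedAddCommGroup E] [InnerProductSpace ℝ E]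
    [CompleteSpace E] {φ : E → ℝ} (hφ : ContDiff ℝ 1 φ) : Continuous (∇ φ) :=
  (InnerProductSpace.toDual ℝ E).symm.continuous.comp (hφ.continuous_fderiv one_ne_zero)

lemma gradient_eq_zero_of_notMem_tsupport {E : Type*} [NormedAddCommGroup E]
    [InnerProductSpace ℝ E] [CompleteSpace E] {φ : E → ℝ} {x : E} (hx : x ∉ tsupport φ) :
    ∇ φ x = 0 := by
  rw [← norm_eq_zero, norm_gradient_eq, norm_eq_zero]
  exact image_eq_zero_of_notMem_tsupport fun h => hx (tsupport_fderiv_subset ℝ h)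

/-- Identifies the gradient in the Sobolev hypothesis with the one in the weak equation, which are
given by separate existential statements. -/
lemma HasWeakGradient.ae_unique {G' : EuclideanSpace ℝ (Fin N) → EuclideanSpace ℝ (Fin N)}
    (h : HasWeakGradient v G) (h' : HasWeakGradient v G') : G =ᵐ[volume] G' := by
  have hz : ∀ᵐ x, (G - G') x = 0 := by
    refine ae_eq_zero_of_integral_contDiff_smul_eq_zero (h.2.1.sub h'.2.1) fun φ hφ hφs => ?_
    have h1 : Integrable (fun x => φ x • G x) :=
      h.2.1.integrable_smul_left_of_hasCompactSupport hφ.continuous hφs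
    have h2 : Integrable (fun x => φ x • G' x) :=
      h'.2.1.integrable_smul_left_of_hasCompactSupport hφ.continuous hφs
    have h3 : Integrable (fun x => φ x • (G - G') x) := by
      refine (h1.sub h2).congr (Eventually.of_forall fun x => ?_)
      simp [smul_sub]
    refine ext_inner_left ℝ fun e => ?_
    rw [inner_zero_right, ← integral_inner h3]
    have e1 := h.2.2 φ hφ hφs e
    have e2 := h'.2.2 φ hφ hφs e
    have e3 : ∫ x, inner ℝ (G x) e * φ x = ∫ x, inner ℝ (G' x) e * φ x := by linarith
    have i1 : Integrable (fun x => inner ℝ (G x) e * φ x) := by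
      refine (h1.inner_const (𝕜 := ℝ) e).congr (Eventually.of_forall fun x => ?_)
      simp [inner_smul_left, mul_comm]
    have i2 : Integrable (fun x => inner ℝ (G' x) e * φ x) := by
      refine (h2.inner_const (𝕜 := ℝ) e).congr (Eventually.of_forall fun x => ?_)
      simp [inner_smul_left, mul_comm]
    rw [← sub_eq_zero, ← integral_sub i1 i2] at e3
    rw [← e3]
    refine integral_congr_ae (Eventually.of_forall fun x => ?_)
    simp only [Pi.sub_apply, inner_smul_right, inner_sub_right, real_inner_comm e]
    ring
  filter_upwards [hz] with x hx
  exact sub_eq_zero.1 hx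

/-- The derivative of the convolution falls on the bump `ρ`, and `t ↦ ρ (x - t)` is an admissible
test function for the weak gradient. The sign from reflecting `t` cancels the sign in the definition
of `HasWeakGradient`. -/
lemma HasWeakGradient.hasGradientAt_mollify (h : HasWeakGradient v G) (n : ℕ)
    (x : EuclideanSpace ℝ (Fin N)) :
    HasGradientAt (mollify volume n v) (mollify volume n G x) x := by
  set ρ := (shrinkingBump (EuclideanSpace ℝ (Fin N)) n).normed volume with hρ
  have hρc : ContDiff ℝ ∞ ρ := (shrinkingBump _ n).contDiff_normed
  have hρs : HasCompactSupport ρ := (shrinkingBump _ n).hasCompactSupport_normed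
  have hder : HasFDerivAt (mollify volume n v)
      ((fderiv ℝ ρ ⋆[(lsmul ℝ ℝ).precompL (EuclideanSpace ℝ (Fin N)), volume] v) x) x :=
    hρs.hasFDerivAt_convolution_left _ (hρc.of_le (by exact_mod_cast le_top)) h.1 x
  have hcont : Continuous (fderiv ℝ ρ) := hρc.continuous_fderiv (by simp)
  suffices heq : InnerProductSpace.toDual ℝ (EuclideanSpace ℝ (Fin N)) (mollify volume n G x) =
      (fderiv ℝ ρ ⋆[(lsmul ℝ ℝ).precompL (EuclideanSpace ℝ (Fin N)), volume] v) x by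
    rw [hasGradientAt_iff_hasFDerivAt, heq]
    exact hder
  refine ContinuousLinearMap.ext fun e => ?_
  rw [InnerProductSpace.toDual_apply_apply]
  have hconv : ConvolutionExistsAt (fderiv ℝ ρ) v x
      ((lsmul ℝ ℝ).precompL (EuclideanSpace ℝ (Fin N))) volume :=
    (hρs.fderiv ℝ).convolutionExists_left _ hcont h.1 x
  rw [convolution_eq_swap, integral_apply hconv.integrable_swap]
  set φ : EuclideanSpace ℝ (Fin N) → ℝ := fun t => ρ (x - t) with hφ
  have hφc : ContDiff ℝ ∞ φ := hρc.comp (contDiff_const.sub contDiff_id)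
  have hφs : HasCompactSupport φ :=
    hρs.comp_homeomorph (Homeomorph.subLeft x)
  have hφd : ∀ t, fderiv ℝ φ t e = - fderiv ℝ ρ (x - t) e := by
    intro t
    have h1 : HasFDerivAt ρ (fderiv ℝ ρ (x - t)) (x - t) :=
      (hρc.differentiable (by simp)).differentiableAt.hasFDerivAt
    have h2 : HasFDerivAt φ ((fderiv ℝ ρ (x - t)).comp
        (-ContinuousLinearMap.id ℝ (EuclideanSpace ℝ (Fin N)))) t :=
      h1.comp t ((hasFDerivAt_id t).const_sub x)
    rw [h2.fderiv]; simp
  have key := h.2.2 φ hφc hφs e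
  have hL : ∀ t, ((lsmul ℝ ℝ).precompL (EuclideanSpace ℝ (Fin N))) (fderiv ℝ ρ (x - t)) (v t) e
      = -(v t * fderiv ℝ φ t e) := by
    intro t
    rw [hφd, precompL_apply]
    simp [mul_comm]
  simp_rw [hL]
  have hint : Integrable fun t => ρ (x - t) • G t :=
    (convolutionExists_shrinkingBump n h.2.1 x).integrable_swap
  rw [integral_neg, key, neg_neg, mollify_apply_swap, real_inner_comm, ← integral_inner hint]
  refine integral_congr_ae (Eventually.of_forall fun t => ?_)
  simp only [inner_smul_right, real_inner_comm e, hφ]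
  ring

lemma hasWeakGradient_of_contDiff {φ : EuclideanSpace ℝ (Fin N) → ℝ} (hφ : ContDiff ℝ 1 φ) :
    HasWeakGradient φ (∇ φ) := by
  refine ⟨hφ.continuous.locallyIntegrable, (continuous_gradient hφ).locallyIntegrable,
    fun ψ hψ hψs e => ?_⟩
  have hψ1 : ContDiff ℝ 1 ψ := hψ.of_le (by exact_mod_cast le_top)
  have c1 : Continuous fun x => fderiv ℝ φ x e :=
    (hφ.continuous_fderiv one_ne_zero).clm_apply continuous_const
  have c2 : Continuous fun x => fderiv ℝ ψ x e :=
    (hψ1.continuous_fderiv one_ne_zero).clm_apply continuous_const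
  have hs2 : HasCompactSupport fun x => fderiv ℝ ψ x e := hψs.fderiv_apply ℝ e
  simp_rw [inner_gradient_left]
  refine integral_mul_fderiv_eq_neg_fderiv_mul_of_integrable ?_ ?_ ?_
    (fun x _ => hφ.differentiable one_ne_zero x) (fun x _ => hψ1.differentiable one_ne_zero x)
  · exact (c1.mul hψ1.continuous).integrable_of_hasCompactSupport hψs.mul_left
  · exact (hφ.continuous.mul c2).integrable_of_hasCompactSupport hs2.mul_left
  · exact (hφ.continuous.mul hψ1.continuous).integrable_of_hasCompactSupport hψs.mul_left

end WeakGradient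

/-! ### Chain rule for `θ * f ∘ v` and its approximation. -/

section ChainRule

open scoped ENNReal

lemma abs_sub_le_of_abs_deriv_le {f : ℝ → ℝ} (hf : Differentiable ℝ f) {Λ : ℝ}
    (hΛ : ∀ t, |deriv f t| ≤ Λ) (s t : ℝ) : |f s - f t| ≤ Λ * |s - t| :=
  Convex.norm_image_sub_le_of_norm_deriv_le (s := Set.univ) (fun x _ => hf x)
    (fun x _ => hΛ x) convex_univ (Set.mem_univ t) (Set.mem_univ s)

lemma memLp_of_restrict_of_support_subset {α F : Type*} {m : MeasurableSpace α}
    {μ : Measure α} [NormedAddCommGroup F] {f : α → F} {q : ℝ≥0∞} {K : Set α}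
    (hK : MeasurableSet K) (hs : Function.support f ⊆ K) (hf : MemLp f q (μ.restrict K)) :
    MemLp f q μ := by
  rw [← Set.indicator_eq_self.2 hs]
  exact (memLp_indicator_iff_restrict hK).2 hf

variable {N : ℕ} {v : EuclideanSpace ℝ (Fin N) → ℝ}
  {G : EuclideanSpace ℝ (Fin N) → EuclideanSpace ℝ (Fin N)}

/-- The weak gradient of `θ * f ∘ v`, where `G` is the weak gradient of `v`. -/
noncomputable def cutoffGradient (θ : EuclideanSpace ℝ (Fin N) → ℝ) (f : ℝ → ℝ)
    (v : EuclideanSpace ℝ (Fin N) → ℝ)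
    (G : EuclideanSpace ℝ (Fin N) → EuclideanSpace ℝ (Fin N)) (x : EuclideanSpace ℝ (Fin N)) :
    EuclideanSpace ℝ (Fin N) :=
  (θ x * deriv f (v x)) • G x + f (v x) • ∇ θ x

variable {θ : EuclideanSpace ℝ (Fin N) → ℝ} {f : ℝ → ℝ} {Λ : ℝ}

lemma support_cutoffGradient_subset :
    Function.support (cutoffGradient θ f v G) ⊆ tsupport θ := by
  intro x hx
  by_contra h
  exact hx (by simp [cutoffGradient, image_eq_zero_of_notMem_tsupport h,
    gradient_eq_zero_of_notMem_tsupport h])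

lemma support_cutoff_mul_subset (g : EuclideanSpace ℝ (Fin N) → ℝ) :
    Function.support (fun x => θ x * g x) ⊆ tsupport θ := by
  intro x hx
  by_contra h
  exact hx (by simp [image_eq_zero_of_notMem_tsupport h])

lemma gradient_cutoff_mul_comp {w : EuclideanSpace ℝ (Fin N) → ℝ} (hθ : ContDiff ℝ 1 θ)
    (hf : ContDiff ℝ 1 f) (x W : EuclideanSpace ℝ (Fin N)) (hw : HasGradientAt w W x) :
    HasGradientAt (fun x => θ x * f (w x))
      ((θ x * deriv f (w x)) • W + f (w x) • ∇ θ x) x := by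
  have h1 := (hθ.differentiable one_ne_zero x).hasGradientAt
  rw [hasGradientAt_iff_hasFDerivAt] at h1 hw ⊢
  have h2 : HasDerivAt f (deriv f (w x)) (w x) :=
    (hf.differentiable one_ne_zero (w x)).hasDerivAt
  have h3 := h1.mul (h2.comp_hasFDerivAt x hw)
  refine h3.congr_fderiv ?_
  refine ContinuousLinearMap.ext fun e => ?_
  simp [mul_assoc]

lemma memLp_cutoff_mul_comp {r : ℝ} (hθ : Continuous θ) (hθs : HasCompactSupport θ)
    (hf : ContDiff ℝ 1 f) (hΛ : ∀ t, |deriv f t| ≤ Λ) (hf0 : f 0 = 0)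
    (hv : MemLpLoc v (ENNReal.ofReal r)) :
    MemLp (fun x => θ x * f (v x)) (ENNReal.ofReal r) volume := by
  obtain ⟨C, hC⟩ := hθs.exists_bound_of_continuous hθ
  refine memLp_of_restrict_of_support_subset hθs.isCompact.measurableSet
    (support_cutoff_mul_subset _) ?_
  have hvK := hv _ hθs.isCompact
  refine hvK.of_le_mul (c := C * Λ) (hθ.aestronglyMeasurable.mul
    (hf.continuous.comp_aestronglyMeasurable hvK.1)) (Eventually.of_forall fun x => ?_)
  rw [norm_mul, mul_assoc]
  have := abs_sub_le_of_abs_deriv_le (hf.differentiable one_ne_zero) hΛ (v x) 0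
  rw [hf0, sub_zero, sub_zero] at this
  exact mul_le_mul (hC x) this (norm_nonneg _) ((norm_nonneg _).trans (hC x))

lemma memLp_cutoff_smul {p : ℝ} (hθ : Continuous θ) (hθs : HasCompactSupport θ)
    (hf : ContDiff ℝ 1 f) (hΛ : ∀ t, |deriv f t| ≤ Λ)
    (hv : MemLpLoc v (ENNReal.ofReal p)) (hG : MemLpLoc G (ENNReal.ofReal p)) :
    MemLp (fun x => (θ x * deriv f (v x)) • G x) (ENNReal.ofReal p) volume := by
  obtain ⟨C, hC⟩ := hθs.exists_bound_of_continuous hθ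
  have hvK := hv _ hθs.isCompact
  have hGK := hG _ hθs.isCompact
  refine memLp_of_restrict_of_support_subset hθs.isCompact.measurableSet (fun x hx => ?_)
    (hGK.of_le_mul (c := C * Λ) ((hθ.aestronglyMeasurable.mul
      (hf.continuous_deriv_one.comp_aestronglyMeasurable hvK.1)).smul hGK.1)
      (Eventually.of_forall fun x => ?_))
  · by_contra h
    exact hx (by simp [image_eq_zero_of_notMem_tsupport h])
  · rw [norm_smul, norm_mul]
    exact mul_le_mul_of_nonneg_right
      (mul_le_mul (hC x) (hΛ _) (norm_nonneg _) ((norm_nonneg _).trans (hC x))) (norm_nonneg _)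

lemma memLp_comp_smul_gradient {p : ℝ} (hθ : ContDiff ℝ 1 θ) (hθs : HasCompactSupport θ)
    (hf : ContDiff ℝ 1 f) (hΛ : ∀ t, |deriv f t| ≤ Λ) (hf0 : f 0 = 0)
    (hv : MemLpLoc v (ENNReal.ofReal p)) :
    MemLp (fun x => f (v x) • ∇ θ x) (ENNReal.ofReal p) volume := by
  obtain ⟨D, hD⟩ := (hθs.fderiv ℝ).exists_bound_of_continuous (hθ.continuous_fderiv one_ne_zero)
  have hvK := hv _ hθs.isCompact
  refine memLp_of_restrict_of_support_subset hθs.isCompact.measurableSet (fun x hx => ?_)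
    (hvK.of_le_mul (c := D * Λ) ((hf.continuous.comp_aestronglyMeasurable hvK.1).smul
      (continuous_gradient hθ).aestronglyMeasurable) (Eventually.of_forall fun x => ?_))
  · by_contra h
    exact hx (by simp [gradient_eq_zero_of_notMem_tsupport h])
  · rw [norm_smul, norm_gradient_eq, mul_comm, mul_assoc]
    have := abs_sub_le_of_abs_deriv_le (hf.differentiable one_ne_zero) hΛ (v x) 0
    rw [hf0, sub_zero, sub_zero] at this
    exact mul_le_mul (hD x) this (norm_nonneg _) ((norm_nonneg _).trans (hD x))

lemma memLp_cutoffGradient {p : ℝ} (hθ : ContDiff ℝ 1 θ) (hθs : HasCompactSupport θ)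
    (hf : ContDiff ℝ 1 f) (hΛ : ∀ t, |deriv f t| ≤ Λ) (hf0 : f 0 = 0)
    (hv : MemLpLoc v (ENNReal.ofReal p)) (hG : MemLpLoc G (ENNReal.ofReal p)) :
    MemLp (cutoffGradient θ f v G) (ENNReal.ofReal p) volume :=
  (memLp_cutoff_smul hθ.continuous hθs hf hΛ hv hG).add
    (memLp_comp_smul_gradient hθ hθs hf hΛ hf0 hv)

lemma tendsto_eLpNorm_cutoff_mul_mollify {r : ℝ} (hr : 1 ≤ r) (hθ : Continuous θ)
    (hθs : HasCompactSupport θ) (hf : ContDiff ℝ 1 f) (hΛ : ∀ t, |deriv f t| ≤ Λ)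
    (hv : MemLpLoc v (ENNReal.ofReal r)) :
    Tendsto (fun n => eLpNorm
      ((fun x => θ x * f (mollify volume n v x)) - fun x => θ x * f (v x))
      (ENNReal.ofReal r) volume) atTop (𝓝 0) := by
  obtain ⟨C, hC⟩ := hθs.exists_bound_of_continuous hθ
  have h0 := ENNReal.Tendsto.const_mul (a := ENNReal.ofReal (C * Λ))
    (tendsto_eLpNorm_mollify_sub_restrict hr hv hθs.isCompact) (Or.inr ENNReal.ofReal_ne_top)
  rw [mul_zero] at h0
  refine tendsto_of_tendsto_of_tendsto_of_le_of_le tendsto_const_nhds h0 (fun _ => bot_le)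
    fun n => ?_
  have hsub : Function.support ((fun x => θ x * f (mollify volume n v x)) -
      fun x => θ x * f (v x)) ⊆ tsupport θ :=
    (Function.support_sub _ _).trans
      (Set.union_subset (support_cutoff_mul_subset _) (support_cutoff_mul_subset _))
  simp only
  rw [← eLpNorm_restrict_eq_of_support_subset hsub]
  refine eLpNorm_le_mul_eLpNorm_of_ae_le_mul (Eventually.of_forall fun x => ?_) _
  simp only [Pi.sub_apply]
  rw [← mul_sub, norm_mul, mul_assoc]
  exact mul_le_mul (hC x) (abs_sub_le_of_abs_deriv_le (hf.differentiable one_ne_zero) hΛ _ _)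
    (norm_nonneg _) ((norm_nonneg _).trans (hC x))

/-- The difference splits into three parts: one controlled by convergence of `mollify G`, one
carrying the change of `f'`, and one controlled by the Lipschitz bound on `f`. -/
lemma tendsto_eLpNorm_cutoffGradient_mollify {p : ℝ} (hp : 1 ≤ p) (hw : HasWeakGradient v G)
    (hθ : ContDiff ℝ 1 θ) (hθs : HasCompactSupport θ)
    (hf : ContDiff ℝ 1 f) (hΛ : ∀ t, |deriv f t| ≤ Λ)
    (hv : MemLpLoc v (ENNReal.ofReal p)) (hG : MemLpLoc G (ENNReal.ofReal p)) :
    Tendsto (fun n => eLpNorm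
      (cutoffGradient θ f (mollify volume n v) (mollify volume n G) - cutoffGradient θ f v G)
      (ENNReal.ofReal p) volume) atTop (𝓝 0) := by
  have hp1 : 1 ≤ ENNReal.ofReal p := by simpa using hp
  obtain ⟨C, hC⟩ := hθs.exists_bound_of_continuous hθ.continuous
  obtain ⟨D, hD⟩ := (hθs.fderiv ℝ).exists_bound_of_continuous (hθ.continuous_fderiv one_ne_zero)
  have hC0 : 0 ≤ C := (norm_nonneg _).trans (hC 0)
  set K := tsupport θ
  have hK : IsCompact K := hθs.isCompact
  have hvK := hv K hK
  have hGK := hG K hK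
  have hfc := hf.continuous_deriv_one
  have hmv : ∀ n, Continuous (mollify volume n v) := fun n => (contDiff_mollify n hw.1).continuous
  have hmG : ∀ n, Continuous (mollify volume n G) :=
    fun n => (contDiff_mollify n hw.2.1).continuous
  set a : ℕ → EuclideanSpace ℝ (Fin N) → EuclideanSpace ℝ (Fin N) := fun n x =>
    (θ x * deriv f (mollify volume n v x)) • (mollify volume n G x - G x) with ha
  set b : ℕ → EuclideanSpace ℝ (Fin N) → EuclideanSpace ℝ (Fin N) := fun n x =>
    (θ x * (deriv f (mollify volume n v x) - deriv f (v x))) • G x with hb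
  set c : ℕ → EuclideanSpace ℝ (Fin N) → EuclideanSpace ℝ (Fin N) := fun n x =>
    (f (mollify volume n v x) - f (v x)) • ∇ θ x with hc
  have ham : ∀ n, AEStronglyMeasurable (a n) (volume.restrict K) := fun n =>
    ((hθ.continuous.mul (hfc.comp (hmv n))).aestronglyMeasurable).smul
      ((hmG n).aestronglyMeasurable.sub hGK.1)
  have hbm : ∀ n, AEStronglyMeasurable (b n) (volume.restrict K) := fun n =>
    (hθ.continuous.aestronglyMeasurable.mul ((hfc.comp (hmv n)).aestronglyMeasurable.sub
      (hfc.comp_aestronglyMeasurable hvK.1))).smul hGK.1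
  have hcm : ∀ n, AEStronglyMeasurable (c n) (volume.restrict K) := fun n =>
    ((hf.continuous.comp (hmv n)).aestronglyMeasurable.sub
      (hf.continuous.comp_aestronglyMeasurable hvK.1)).smul
      (continuous_gradient hθ).aestronglyMeasurable
  have ha0 : Tendsto (fun n => eLpNorm (a n) (ENNReal.ofReal p) (volume.restrict K))
      atTop (𝓝 0) := by
    have h0 := ENNReal.Tendsto.const_mul (a := ENNReal.ofReal (C * Λ))
      (tendsto_eLpNorm_mollify_sub_restrict hp hG hK) (Or.inr ENNReal.ofReal_ne_top)
    rw [mul_zero] at h0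
    refine tendsto_of_tendsto_of_tendsto_of_le_of_le tendsto_const_nhds h0 (fun _ => bot_le)
      fun n => eLpNorm_le_mul_eLpNorm_of_ae_le_mul (Eventually.of_forall fun x => ?_) _
    simp only [ha]
    rw [norm_smul, norm_mul]
    exact mul_le_mul_of_nonneg_right
      (mul_le_mul (hC x) (hΛ _) (norm_nonneg _) hC0) (norm_nonneg _)
  have hc0 : Tendsto (fun n => eLpNorm (c n) (ENNReal.ofReal p) (volume.restrict K))
      atTop (𝓝 0) := by
    have h0 := ENNReal.Tendsto.const_mul (a := ENNReal.ofReal (D * Λ))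
      (tendsto_eLpNorm_mollify_sub_restrict hp hv hK) (Or.inr ENNReal.ofReal_ne_top)
    rw [mul_zero] at h0
    refine tendsto_of_tendsto_of_tendsto_of_le_of_le tendsto_const_nhds h0 (fun _ => bot_le)
      fun n => eLpNorm_le_mul_eLpNorm_of_ae_le_mul (Eventually.of_forall fun x => ?_) _
    simp only [hc]
    rw [norm_smul, norm_gradient_eq, mul_comm, mul_assoc]
    exact mul_le_mul (hD x) (abs_sub_le_of_abs_deriv_le (hf.differentiable one_ne_zero) hΛ _ _)
      (norm_nonneg _) ((norm_nonneg _).trans (hD x))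
  -- Since `f'` is merely continuous and bounded, this part is handled by almost everywhere
  -- convergence of the mollifications and domination by `2 C Λ ‖G‖`.
  have hb0 : Tendsto (fun n => eLpNorm (b n) (ENNReal.ofReal p) (volume.restrict K))
      atTop (𝓝 0) := by
    refine tendsto_eLpNorm_zero_of_dominated (by linarith) hbm
      (b := fun x => (C * (Λ + Λ)) * ‖G x‖) (hGK.norm.const_mul _) (fun n => ?_) ?_
    · refine Eventually.of_forall fun x => ?_
      simp only [hb]
      rw [norm_smul, norm_mul]
      refine mul_le_mul_of_nonneg_right
        (mul_le_mul (hC x) ?_ (norm_nonneg _) hC0) (norm_nonneg _)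
      exact (norm_sub_le _ _).trans (add_le_add (hΛ _) (hΛ _))
    · filter_upwards [ae_restrict_of_ae (ae_tendsto_mollify hw.1)] with x hx
      have h1 : Tendsto (fun n => deriv f (mollify volume n v x)) atTop (𝓝 (deriv f (v x))) :=
        (hfc.tendsto _).comp hx
      have h2 := ((h1.sub_const (deriv f (v x))).const_mul (θ x)).smul_const (G x)
      simpa [hb] using h2
  have hsum := (ha0.add hb0).add hc0
  simp only [add_zero] at hsum
  refine tendsto_of_tendsto_of_tendsto_of_le_of_le tendsto_const_nhds hsum (fun _ => bot_le)
    fun n => ?_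
  have hsub : Function.support (cutoffGradient θ f (mollify volume n v) (mollify volume n G) -
      cutoffGradient θ f v G) ⊆ K :=
    (Function.support_sub _ _).trans
      (Set.union_subset support_cutoffGradient_subset support_cutoffGradient_subset)
  simp only
  rw [← eLpNorm_restrict_eq_of_support_subset hsub]
  have hdec : cutoffGradient θ f (mollify volume n v) (mollify volume n G) -
      cutoffGradient θ f v G = a n + b n + c n := by
    funext x
    simp only [cutoffGradient, Pi.sub_apply, Pi.add_apply, ha, hb, hc]
    module
  rw [hdec]
  exact (eLpNorm_add_le ((ham n).add (hbm n)) (hcm n) hp1).trans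
    (add_le_add_left (eLpNorm_add_le (ham n) (hbm n) hp1) _)

end ChainRule

/-! ### The Sobolev inequality for truncated and cut-off functions. -/

section Sobolev

open scoped ENNReal NNReal

variable {N : ℕ}

/-- The Sobolev inequality for `θ * f ∘ v` with `v` weakly differentiable. -/
lemma exists_eLpNorm_cutoff_mul_comp_le {p q : ℝ} (hp : 1 ≤ p) (hN : 0 < N) (hq : 0 < q)
    (hpq : q⁻¹ = p⁻¹ - (N : ℝ)⁻¹) :
    ∃ S : ℝ≥0, ∀ (v : EuclideanSpace ℝ (Fin N) → ℝ)
      (G : EuclideanSpace ℝ (Fin N) → EuclideanSpace ℝ (Fin N)), HasWeakGradient v G →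
      MemLpLoc v (ENNReal.ofReal p) → MemLpLoc G (ENNReal.ofReal p) →
      ∀ θ : EuclideanSpace ℝ (Fin N) → ℝ, ContDiff ℝ 1 θ → HasCompactSupport θ →
      ∀ (f : ℝ → ℝ) (Λ : ℝ), ContDiff ℝ 1 f → (∀ t, |deriv f t| ≤ Λ) → f 0 = 0 →
      eLpNorm (fun x => θ x * f (v x)) (ENNReal.ofReal q) volume ≤
        S * eLpNorm (cutoffGradient θ f v G) (ENNReal.ofReal p) volume := by
  refine ⟨SNormLESNormFDerivOfEqConst ℝ (volume : Measure (EuclideanSpace ℝ (Fin N))) p.toNNReal,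
    fun v G hw hv hG θ hθ hθs f Λ hf hΛ hf0 => ?_⟩
  set S := SNormLESNormFDerivOfEqConst ℝ (volume : Measure (EuclideanSpace ℝ (Fin N))) p.toNNReal
  have hp1 : 1 ≤ ENNReal.ofReal p := by simpa using hp
  have hmv : ∀ n, ContDiff ℝ 1 (mollify volume n v) :=
    fun n => (contDiff_mollify n hw.1).of_le (by exact_mod_cast le_top)
  set u : ℕ → EuclideanSpace ℝ (Fin N) → ℝ := fun n x => θ x * f (mollify volume n v x) with hu
  have huc : ∀ n, ContDiff ℝ 1 (u n) := fun n => hθ.mul (hf.comp (hmv n))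
  have hus : ∀ n, HasCompactSupport (u n) := fun n => hθs.mul_right
  have hgrad : ∀ n x, ∇ (u n) x = cutoffGradient θ f (mollify volume n v) (mollify volume n G) x :=
    fun n x => (gradient_cutoff_mul_comp hθ hf x _ (hw.hasGradientAt_mollify n x)).gradient
  have hsob : ∀ n, eLpNorm (u n) (ENNReal.ofReal q) volume ≤
      S * eLpNorm (cutoffGradient θ f (mollify volume n v) (mollify volume n G))
        (ENNReal.ofReal p) volume := by
    intro n
    have h1 := eLpNorm_le_eLpNorm_fderiv_of_eq (μ := volume) (huc n) (hus n) (p := p.toNNReal)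
      (p' := q.toNNReal) (by simpa using hp) (by simpa using hN) (by
        rw [Real.coe_toNNReal _ hq.le, NNReal.coe_inv, Real.coe_toNNReal _ (by linarith)]
        simpa using hpq)
    refine h1.trans (le_of_eq ?_)
    congr 1
    refine eLpNorm_congr_norm_ae (Eventually.of_forall fun x => ?_)
    rw [← norm_gradient_eq, hgrad]
  -- Fatou on the left: no integrability of `v` with exponent `q` is known here, so only almost
  -- everywhere convergence is used. On the right the gradients converge in `L^p`.
  have hfat := Lp.eLpNorm_lim_le_liminf_eLpNorm (p := ENNReal.ofReal q) (μ := volume)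
    (fun n => (huc n).continuous.aestronglyMeasurable) (fun x => θ x * f (v x)) (by
      filter_upwards [ae_tendsto_mollify hw.1] with x hx
      exact ((hf.continuous.tendsto _).comp hx).const_mul _)
  refine hfat.trans ?_
  have hlim : Tendsto (fun n => S * (eLpNorm
      (cutoffGradient θ f (mollify volume n v) (mollify volume n G) - cutoffGradient θ f v G)
      (ENNReal.ofReal p) volume + eLpNorm (cutoffGradient θ f v G) (ENNReal.ofReal p) volume))
      atTop (𝓝 (S * eLpNorm (cutoffGradient θ f v G) (ENNReal.ofReal p) volume)) := by
    have := ENNReal.Tendsto.const_mul (a := (S : ℝ≥0∞))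
      ((tendsto_eLpNorm_cutoffGradient_mollify hp hw hθ hθs hf hΛ hv hG).add_const
        (eLpNorm (cutoffGradient θ f v G) (ENNReal.ofReal p) volume))
      (Or.inr ENNReal.coe_ne_top)
    rwa [zero_add] at this
  rw [← hlim.liminf_eq]
  refine liminf_le_liminf (Eventually.of_forall fun n => (hsob n).trans ?_)
  gcongr
  have hm := (memLp_cutoffGradient hθ hθs hf hΛ hf0 hv hG).1
  have hm' : AEStronglyMeasurable (cutoffGradient θ f (mollify volume n v) (mollify volume n G))
      volume := by
    have : cutoffGradient θ f (mollify volume n v) (mollify volume n G) = ∇ (u n) :=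
      funext fun x => (hgrad n x).symm
    rw [this]
    exact (continuous_gradient (huc n)).aestronglyMeasurable
  have := eLpNorm_add_le (hm'.sub hm) hm hp1
  rwa [sub_add_cancel] at this

lemma exists_cutoff_eq_one {K : Set (EuclideanSpace ℝ (Fin N))} (hK : IsCompact K) :
    ∃ θ : EuclideanSpace ℝ (Fin N) → ℝ, ContDiff ℝ 1 θ ∧ HasCompactSupport θ ∧
      (∀ x, 0 ≤ θ x) ∧ ∀ x ∈ K, θ x = 1 := by
  obtain ⟨R, hR⟩ := hK.isBounded.subset_closedBall 0
  let φ : ContDiffBump (0 : EuclideanSpace ℝ (Fin N)) :=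
    ⟨max R 1, max R 1 + 1, by positivity, by linarith⟩
  refine ⟨φ, φ.contDiff, φ.hasCompactSupport, fun x => φ.nonneg, fun x hx => ?_⟩
  exact φ.one_of_mem_closedBall (Metric.closedBall_subset_closedBall (le_max_left _ _) (hR hx))

/-- The preceding inequality with `f` the identity and a cutoff equal to `1` on `K`. -/
lemma memLpLoc_of_hasWeakGradient {p q : ℝ} (hp : 1 ≤ p) (hN : 0 < N) (hq : 0 < q)
    (hpq : q⁻¹ = p⁻¹ - (N : ℝ)⁻¹) {v : EuclideanSpace ℝ (Fin N) → ℝ}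
    {G : EuclideanSpace ℝ (Fin N) → EuclideanSpace ℝ (Fin N)} (hw : HasWeakGradient v G)
    (hv : MemLpLoc v (ENNReal.ofReal p)) (hG : MemLpLoc G (ENNReal.ofReal p)) :
    MemLpLoc v (ENNReal.ofReal q) := by
  intro K hK
  obtain ⟨θ, hθ, hθs, -, hθ1⟩ := exists_cutoff_eq_one hK
  obtain ⟨S, hS⟩ := exists_eLpNorm_cutoff_mul_comp_le hp hN hq hpq
  have hid : ∀ t : ℝ, |deriv (fun t : ℝ => t) t| ≤ 1 := by simp
  have h1 := hS v G hw hv hG θ hθ hθs (fun t => t) 1 contDiff_id hid rfl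
  refine ⟨(hv K hK).1, ?_⟩
  have h2 : eLpNorm v (ENNReal.ofReal q) (volume.restrict K) =
      eLpNorm (fun x => θ x * v x) (ENNReal.ofReal q) (volume.restrict K) := by
    refine eLpNorm_congr_ae ?_
    filter_upwards [ae_restrict_mem hK.measurableSet] with x hx
    simp [hθ1 x hx]
  rw [h2]
  refine ((eLpNorm_mono_measure _ Measure.restrict_le_self).trans h1).trans_lt ?_
  exact ENNReal.mul_lt_top ENNReal.coe_lt_top
    (memLp_cutoffGradient hθ hθs contDiff_id hid rfl hv hG).2

end Sobolev

/-! ### Admissible test functions for the weak equation. -/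

section WeakForm

open scoped ENNReal

variable {N : ℕ}

/-- Rounding `v` down to the grid of mesh `1/(n+1)` leaves countably many values of `t`, for which
measurability of each `h(·, t)` is enough. Continuity in `t` then gives the limit. -/
lemma IsCaratheodoryFun.aemeasurable_comp {h : EuclideanSpace ℝ (Fin N) → ℝ → ℝ}
    (hh : IsCaratheodoryFun h) {v : EuclideanSpace ℝ (Fin N) → ℝ} (hv : AEMeasurable v volume) :
    AEMeasurable (fun x => h x (v x)) volume := by
  set w := hv.mk v
  have hw : Measurable w := hv.measurable_mk
  suffices hs : AEMeasurable (fun x => h x (w x)) volume by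
    refine hs.congr ?_
    filter_upwards [hv.ae_eq_mk] with x hx
    rw [hx]
  have hgrid : ∀ n : ℕ, AEMeasurable
      (fun x => h x ((⌊((n : ℝ) + 1) * w x⌋ : ℝ) / ((n : ℝ) + 1))) volume := by
    intro n
    choose F hFm hFe using hh.1
    have hF : Measurable fun z : ℤ × EuclideanSpace ℝ (Fin N) =>
        F ((z.1 : ℝ) / ((n : ℝ) + 1)) z.2 :=
      measurable_from_prod_countable_right fun k => hFm ((k : ℝ) / ((n : ℝ) + 1))
    have hfl : Measurable fun x => (⌊((n : ℝ) + 1) * w x⌋, x) :=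
      (Int.measurable_floor.comp (hw.const_mul _)).prodMk measurable_id
    -- The exceptional set of `F t` depends on `t`; only countably many `t` occur, so their union is
    -- still null.
    have hall : ∀ᵐ x, ∀ k : ℤ,
        h x ((k : ℝ) / ((n : ℝ) + 1)) = F ((k : ℝ) / ((n : ℝ) + 1)) x :=
      ae_all_iff.2 fun k => hFe _
    refine (hF.comp hfl).aemeasurable.congr ?_
    filter_upwards [hall] with x hx using (hx _).symm
  refine aemeasurable_of_tendsto_metrizable_ae atTop hgrid ?_
  filter_upwards [hh.2] with x hx
  refine (hx.tendsto (w x)).comp ?_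
  rw [tendsto_iff_dist_tendsto_zero]
  refine squeeze_zero (fun _ => dist_nonneg) (fun n => ?_)
    (tendsto_one_div_add_atTop_nhds_zero_nat (𝕜 := ℝ))
  have hn : (0 : ℝ) < (n : ℝ) + 1 := by positivity
  have e1 := Int.floor_le (((n : ℝ) + 1) * w x)
  have e2 := Int.lt_floor_add_one (((n : ℝ) + 1) * w x)
  have e3 : (⌊((n : ℝ) + 1) * w x⌋ : ℝ) / ((n : ℝ) + 1) - w x =
      ((⌊((n : ℝ) + 1) * w x⌋ : ℝ) - ((n : ℝ) + 1) * w x) / ((n : ℝ) + 1) := by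
    field_simp
  rw [Real.dist_eq, e3, abs_div, abs_of_pos hn]
  gcongr
  rw [abs_le]
  constructor <;> linarith

lemma memLp_norm_rpow_of_div {α F : Type*} {m : MeasurableSpace α} {μ : Measure α}
    [NormedAddCommGroup F] {f : α → F} {q t : ℝ} (ht : 0 < t)
    (hf : MemLp f (ENNReal.ofReal q) μ) :
    MemLp (fun x => ‖f x‖ ^ t) (ENNReal.ofReal (q / t)) μ := by
  have := hf.norm_rpow_div (ENNReal.ofReal t)
  rwa [ENNReal.toReal_ofReal ht.le, ← ENNReal.ofReal_div_of_pos ht] at this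

lemma norm_rpow_sub_two_smul {V : Type*} [NormedAddCommGroup V] [NormedSpace ℝ V] {p : ℝ}
    (hp : 1 < p) (w : V) : ‖‖w‖ ^ (p - 2) • w‖ = ‖w‖ ^ (p - 1) := by
  rw [norm_smul, Real.norm_of_nonneg (by positivity)]
  rcases eq_or_ne w 0 with rfl | hw
  · simp [Real.zero_rpow (by linarith : p - 1 ≠ 0)]
  · have : 0 < ‖w‖ := norm_pos_iff.2 hw
    nth_rewrite 2 [← Real.rpow_one ‖w‖]
    rw [← Real.rpow_add this]
    congr 1; ring

lemma memLpLoc_rpow_sub_two_smul {p : ℝ} (hp : 1 < p)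
    {G : EuclideanSpace ℝ (Fin N) → EuclideanSpace ℝ (Fin N)}
    (hG : MemLpLoc G (ENNReal.ofReal p)) :
    MemLpLoc (fun x => ‖G x‖ ^ (p - 2) • G x) (ENNReal.ofReal (p / (p - 1))) := by
  intro K hK
  have h1 := memLp_norm_rpow_of_div (t := p - 1) (by linarith) (hG K hK)
  have hm : AEStronglyMeasurable (fun x => ‖G x‖ ^ (p - 2) • G x) (volume.restrict K) :=
    ((hG K hK).1.norm.aemeasurable.pow_const _).aestronglyMeasurable.smul (hG K hK).1
  refine h1.of_le hm (Eventually.of_forall fun x => ?_)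
  rw [norm_rpow_sub_two_smul hp, Real.norm_of_nonneg (by positivity)]

/-- The right-hand side lies in the dual of `L^q` locally. -/
lemma memLp_restrict_of_le_mul_rpow {p q : ℝ} (hp : 1 < p) (hpN : p < (N : ℝ)) (hq : 1 < q)
    (hpq : q⁻¹ = p⁻¹ - (N : ℝ)⁻¹) {H v a : EuclideanSpace ℝ (Fin N) → ℝ}
    {K : Set (EuclideanSpace ℝ (Fin N))} (hK : IsCompact K) {M : ℝ}
    (ha : MemLp a (ENNReal.ofReal ((N : ℝ) / p)) (volume.restrict K))
    (hv : MemLp v (ENNReal.ofReal q) (volume.restrict K))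
    (hH : AEStronglyMeasurable H (volume.restrict K))
    (hle : ∀ᵐ x ∂(volume.restrict K), |H x| ≤ (M + a x) * |v x| ^ (p - 1)) :
    MemLp H (ENNReal.ofReal (q / (q - 1))) (volume.restrict K) := by
  have hfin : IsFiniteMeasure (volume.restrict K) :=
    isFiniteMeasure_restrict.2 hK.measure_lt_top.ne
  have h1 := memLp_norm_rpow_of_div (t := p - 1) (by linarith) hv
  have h2 : MemLp (fun x => M + a x) (ENNReal.ofReal ((N : ℝ) / p)) (volume.restrict K) :=
    (memLp_const M).add ha
  have hN0 : (0 : ℝ) < N := by linarith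
  -- The Sobolev relation in disguise: `p/N + (p-1)/q = (q-1)/q`.
  have htri : ((N : ℝ) / p).HolderTriple (q / (p - 1)) (q / (q - 1)) := by
    refine ⟨?_, by positivity, div_pos (by linarith) (by linarith)⟩
    rw [inv_div, inv_div, inv_div]
    have e1 : (p - 1) / q = (p - 1) * (p⁻¹ - (N : ℝ)⁻¹) := by rw [div_eq_mul_inv, hpq]
    have e2 : (q - 1) / q = 1 - (p⁻¹ - (N : ℝ)⁻¹) := by
      rw [sub_div, div_self (by linarith), one_div, hpq]
    rw [e1, e2]
    field_simp
    ring
  have := htri.ennrealOfReal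
  have h3 : MemLp (fun x => (M + a x) * ‖v x‖ ^ (p - 1)) (ENNReal.ofReal (q / (q - 1)))
      (volume.restrict K) := h1.mul h2
  refine h3.of_le hH ?_
  filter_upwards [hle] with x hx
  exact hx.trans (le_abs_self _)

/-- The limit passage shared by both enlargements of the test class. A common compact `K` containing
all supports lets local integrability of `X` and `H` suffice. -/
lemma integral_inner_eq_of_tendsto {p p' q q' : ℝ} (hp : p'.HolderConjugate p)
    (hq : q'.HolderConjugate q) {K : Set (EuclideanSpace ℝ (Fin N))}
    {X : EuclideanSpace ℝ (Fin N) → EuclideanSpace ℝ (Fin N)} {H : EuclideanSpace ℝ (Fin N) → ℝ}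
    (hX : MemLp X (ENNReal.ofReal p') (volume.restrict K))
    (hH : MemLp H (ENNReal.ofReal q') (volume.restrict K))
    {Φn : ℕ → EuclideanSpace ℝ (Fin N) → EuclideanSpace ℝ (Fin N)}
    {Φ : EuclideanSpace ℝ (Fin N) → EuclideanSpace ℝ (Fin N)}
    {φn : ℕ → EuclideanSpace ℝ (Fin N) → ℝ} {φ : EuclideanSpace ℝ (Fin N) → ℝ}
    (hΦn : ∀ n, MemLp (Φn n) (ENNReal.ofReal p) volume) (hΦ : MemLp Φ (ENNReal.ofReal p) volume)
    (hφn : ∀ n, MemLp (φn n) (ENNReal.ofReal q) volume) (hφ : MemLp φ (ENNReal.ofReal q) volume)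
    (hΦnK : ∀ n, Function.support (Φn n) ⊆ K) (hΦK : Function.support Φ ⊆ K)
    (hφnK : ∀ n, Function.support (φn n) ⊆ K) (hφK : Function.support φ ⊆ K)
    (hΦlim : Tendsto (fun n => eLpNorm (Φn n - Φ) (ENNReal.ofReal p) volume) atTop (𝓝 0))
    (hφlim : Tendsto (fun n => eLpNorm (φn n - φ) (ENNReal.ofReal q) volume) atTop (𝓝 0))
    (heq : ∀ n, ∫ x, inner ℝ (X x) (Φn n x) = ∫ x, H x * φn n x) :
    ∫ x, inner ℝ (X x) (Φ x) = ∫ x, H x * φ x := by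
  have hr : ∀ {F : Type} [NormedAddCommGroup F] (u : ℕ → EuclideanSpace ℝ (Fin N) → F) (r : ℝ≥0∞),
      Tendsto (fun n => eLpNorm (u n) r volume) atTop (𝓝 0) →
      Tendsto (fun n => eLpNorm (u n) r (volume.restrict K)) atTop (𝓝 0) := fun u r hu =>
    tendsto_of_tendsto_of_tendsto_of_le_of_le tendsto_const_nhds hu (fun _ => bot_le)
      fun n => eLpNorm_mono_measure _ Measure.restrict_le_self
  have h1 := tendsto_integral_inner hp hX (fun n => (hΦn n).restrict K) (hΦ.restrict K)
    (hr (fun n => Φn n - Φ) _ hΦlim)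
  have h2 := tendsto_integral_inner hq hH (fun n => (hφn n).restrict K) (hφ.restrict K)
    (hr (fun n => φn n - φ) _ hφlim)
  have e1 : ∀ Ψ : EuclideanSpace ℝ (Fin N) → EuclideanSpace ℝ (Fin N), Function.support Ψ ⊆ K →
      ∫ x in K, inner ℝ (X x) (Ψ x) = ∫ x, inner ℝ (X x) (Ψ x) := fun Ψ hΨ =>
    setIntegral_eq_integral_of_forall_compl_eq_zero fun x hx => by
      rw [Function.notMem_support.1 fun h => hx (hΨ h), inner_zero_right]
  have e2 : ∀ ψ : EuclideanSpace ℝ (Fin N) → ℝ, Function.support ψ ⊆ K →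
      ∫ x in K, inner ℝ (H x) (ψ x) = ∫ x, H x * ψ x := fun ψ hψ => by
    rw [setIntegral_eq_integral_of_forall_compl_eq_zero fun x hx => by
      rw [Function.notMem_support.1 fun h => hx (hψ h), inner_zero_right]]
    simp [mul_comm]
  rw [e1 Φ hΦK] at h1
  rw [e2 φ hφK] at h2
  refine tendsto_nhds_unique h1 (h2.congr fun n => ?_)
  rw [e1 _ (hΦnK n), e2 _ (hφnK n), heq n]

variable {p p' q q' : ℝ} {X : EuclideanSpace ℝ (Fin N) → EuclideanSpace ℝ (Fin N)}
  {H : EuclideanSpace ℝ (Fin N) → ℝ}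

/-- An identity tested against smooth functions extends to `C^1` test functions. -/
lemma weakForm_of_contDiff_one (hp : p'.HolderConjugate p) (hq : q'.HolderConjugate q)
    (hX : MemLpLoc X (ENNReal.ofReal p')) (hH : MemLpLoc H (ENNReal.ofReal q'))
    (hweak : ∀ φ : EuclideanSpace ℝ (Fin N) → ℝ, ContDiff ℝ ∞ φ → HasCompactSupport φ →
      ∫ x, inner ℝ (X x) (∇ φ x) = ∫ x, H x * φ x)
    {φ : EuclideanSpace ℝ (Fin N) → ℝ} (hφ : ContDiff ℝ 1 φ) (hφs : HasCompactSupport φ) :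
    ∫ x, inner ℝ (X x) (∇ φ x) = ∫ x, H x * φ x := by
  set K := Metric.cthickening 1 (tsupport φ) with hKdef
  have hK : IsCompact K := hφs.cthickening
  have hloc : LocallyIntegrable φ volume := hφ.continuous.locallyIntegrable
  have hgc := continuous_gradient hφ
  have hgs : HasCompactSupport (∇ φ) := HasCompactSupport.intro hφs.isCompact
    fun x hx => gradient_eq_zero_of_notMem_tsupport hx
  have hgrad : ∀ n x, ∇ (mollify volume n φ) x = mollify volume n (∇ φ) x := fun n x =>
    ((hasWeakGradient_of_contDiff hφ).hasGradientAt_mollify n x).gradient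
  have hsub : tsupport φ ⊆ K := Metric.self_subset_cthickening _
  have hts : ∀ n, tsupport (mollify volume n φ) ⊆ K := fun n =>
    closure_minimal (fun x hx => by
      by_contra hxK
      exact hx (mollify_eq_zero_of_notMem_cthickening n hxK)) Metric.isClosed_cthickening
  have hΦm : MemLp (∇ φ) (ENNReal.ofReal p) volume := hgc.memLp_of_hasCompactSupport hgs
  have hφm : MemLp φ (ENNReal.ofReal q) volume := hφ.continuous.memLp_of_hasCompactSupport hφs
  refine integral_inner_eq_of_tendsto (Φn := fun n => mollify volume n (∇ φ))
    (φn := fun n => mollify volume n φ) hp hq (hX K hK) (hH K hK) (fun n => ?_) hΦm (fun n => ?_)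
    hφm (fun n => ?_) ?_ (fun n => (subset_tsupport _).trans (hts n))
    ((subset_tsupport _).trans hsub) (tendsto_eLpNorm_mollify_sub hp.symm.lt.le hΦm)
    (tendsto_eLpNorm_mollify_sub hq.symm.lt.le hφm) fun n => ?_
  · exact (contDiff_mollify n hgc.locallyIntegrable).continuous.memLp_of_hasCompactSupport
      (hasCompactSupport_mollify n hgs)
  · exact (contDiff_mollify n hloc).continuous.memLp_of_hasCompactSupport
      (hasCompactSupport_mollify n hφs)
  · intro x hx
    by_contra hxK
    refine hx ?_
    rw [← hgrad]
    exact gradient_eq_zero_of_notMem_tsupport fun h => hxK (hts n h)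
  · intro x hx
    by_contra hxK
    exact hx (gradient_eq_zero_of_notMem_tsupport fun h => hxK (hsub h))
  · rw [← hweak _ (contDiff_mollify n hloc) (hasCompactSupport_mollify n hφs)]
    simp_rw [hgrad]

/-- An identity tested against smooth functions may be tested against `θ * f ∘ v`. -/
lemma weakForm_cutoff_mul_comp (hp : p'.HolderConjugate p) (hq : q'.HolderConjugate q)
    (hX : MemLpLoc X (ENNReal.ofReal p')) (hH : MemLpLoc H (ENNReal.ofReal q'))
    (hweak : ∀ φ : EuclideanSpace ℝ (Fin N) → ℝ, ContDiff ℝ ∞ φ → HasCompactSupport φ →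
      ∫ x, inner ℝ (X x) (∇ φ x) = ∫ x, H x * φ x)
    {v : EuclideanSpace ℝ (Fin N) → ℝ}
    {G : EuclideanSpace ℝ (Fin N) → EuclideanSpace ℝ (Fin N)} (hw : HasWeakGradient v G)
    (hv : MemLpLoc v (ENNReal.ofReal p)) (hvq : MemLpLoc v (ENNReal.ofReal q))
    (hG : MemLpLoc G (ENNReal.ofReal p)) {θ : EuclideanSpace ℝ (Fin N) → ℝ}
    (hθ : ContDiff ℝ 1 θ) (hθs : HasCompactSupport θ) {f : ℝ → ℝ} {Λ : ℝ}
    (hf : ContDiff ℝ 1 f) (hΛ : ∀ t, |deriv f t| ≤ Λ) (hf0 : f 0 = 0) :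
    ∫ x, inner ℝ (X x) (cutoffGradient θ f v G x) = ∫ x, H x * (θ x * f (v x)) := by
  have hmv : ∀ n, ContDiff ℝ 1 (mollify volume n v) :=
    fun n => (contDiff_mollify n hw.1).of_le (by exact_mod_cast le_top)
  have huc : ∀ n, ContDiff ℝ 1 (fun x => θ x * f (mollify volume n v x)) :=
    fun n => hθ.mul (hf.comp (hmv n))
  have hus : ∀ n, HasCompactSupport (fun x => θ x * f (mollify volume n v x)) :=
    fun n => hθs.mul_right
  have hgrad : ∀ n x, ∇ (fun x => θ x * f (mollify volume n v x)) x =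
      cutoffGradient θ f (mollify volume n v) (mollify volume n G) x :=
    fun n x => (gradient_cutoff_mul_comp hθ hf x _ (hw.hasGradientAt_mollify n x)).gradient
  have hmemloc : ∀ {F : Type} [NormedAddCommGroup F] (u : EuclideanSpace ℝ (Fin N) → F)
      (r : ℝ≥0∞), Continuous u → MemLpLoc u r := fun u r hu K hK => by
    obtain ⟨C, hC⟩ := hK.exists_bound_of_continuousOn hu.continuousOn
    have : IsFiniteMeasure (volume.restrict K) :=
      isFiniteMeasure_restrict.2 hK.measure_lt_top.ne
    refine MemLp.of_bound hu.aestronglyMeasurable C ?_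
    filter_upwards [ae_restrict_mem hK.measurableSet] with x hx using hC x hx
  have hmG : ∀ n, Continuous (mollify volume n G) :=
    fun n => (contDiff_mollify n hw.2.1).continuous
  refine integral_inner_eq_of_tendsto (K := tsupport θ)
    (Φn := fun n => cutoffGradient θ f (mollify volume n v) (mollify volume n G))
    (φn := fun n x => θ x * f (mollify volume n v x)) hp hq (hX _ hθs.isCompact)
    (hH _ hθs.isCompact) (fun n => ?_) (memLp_cutoffGradient hθ hθs hf hΛ hf0 hv hG) (fun n => ?_)
    (memLp_cutoff_mul_comp hθ.continuous hθs hf hΛ hf0 hvq)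
    (fun n => support_cutoffGradient_subset) support_cutoffGradient_subset
    (fun n => support_cutoff_mul_subset _) (support_cutoff_mul_subset _)
    (tendsto_eLpNorm_cutoffGradient_mollify hp.symm.lt.le hw hθ hθs hf hΛ hv hG)
    (tendsto_eLpNorm_cutoff_mul_mollify hq.symm.lt.le hθ.continuous hθs hf hΛ hvq) fun n => ?_
  · exact memLp_cutoffGradient hθ hθs hf hΛ hf0 (hmemloc _ _ (hmv n).continuous)
      (hmemloc _ _ (hmG n))
  · exact (huc n).continuous.memLp_of_hasCompactSupport (hus n)
  -- Mollifying `v` alone leaves a test function no smoother than `θ` and `f`, hence the need for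
  -- `C^1` test functions.
  · rw [← weakForm_of_contDiff_one hp hq hX hH hweak (huc n) (hus n)]
    simp_rw [hgrad]

end WeakForm

/-! ### Truncated powers, with constants independent of the level `L`. -/

section TruncatedPower

/-- The power `|t| ^ β`, frozen once `|t|` exceeds `L`. -/
noncomputable def truncPow (L β t : ℝ) : ℝ := min |t| L ^ β

/-- The primitive of `truncPow L β` that vanishes at `0`. -/
noncomputable def truncPrim (L β t : ℝ) : ℝ := ∫ s in (0 : ℝ)..t, truncPow L β s

variable {L β : ℝ}

lemma continuous_truncPow (hβ : 0 ≤ β) : Continuous (truncPow L β) :=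
  (continuous_abs.min continuous_const).rpow_const fun _ => Or.inr hβ

lemma truncPow_nonneg (hL : 0 ≤ L) (t : ℝ) : 0 ≤ truncPow L β t :=
  Real.rpow_nonneg (le_min (abs_nonneg t) hL) _

lemma truncPow_le (hL : 0 ≤ L) (hβ : 0 ≤ β) (t : ℝ) : truncPow L β t ≤ L ^ β :=
  Real.rpow_le_rpow (le_min (abs_nonneg t) hL) (min_le_right _ _) hβ

lemma truncPow_le_rpow_abs (hL : 0 ≤ L) (hβ : 0 ≤ β) (t : ℝ) : truncPow L β t ≤ |t| ^ β :=
  Real.rpow_le_rpow (le_min (abs_nonneg t) hL) (min_le_left _ _) hβ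

lemma truncPow_mono (hL : 0 ≤ L) (hβ : 0 ≤ β) {s t : ℝ} (hst : |s| ≤ |t|) :
    truncPow L β s ≤ truncPow L β t :=
  Real.rpow_le_rpow (le_min (abs_nonneg s) hL) (min_le_min_right _ hst) hβ

lemma truncPow_abs (t : ℝ) : truncPow L β |t| = truncPow L β t := by simp [truncPow]

lemma truncPow_rpow (hL : 0 ≤ L) (p t : ℝ) : truncPow L β t ^ p = truncPow L (β * p) t :=
  (Real.rpow_mul (le_min (abs_nonneg t) hL) β p).symm

lemma truncPow_of_abs_le {t : ℝ} (ht : |t| ≤ L) : truncPow L β t = |t| ^ β := by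
  rw [truncPow, min_eq_left ht]

lemma truncPrim_zero : truncPrim L β 0 = 0 := intervalIntegral.integral_same

lemma hasDerivAt_truncPrim (hβ : 0 ≤ β) (t : ℝ) :
    HasDerivAt (truncPrim L β) (truncPow L β t) t :=
  intervalIntegral.integral_hasDerivAt_right ((continuous_truncPow hβ).intervalIntegrable _ _)
    ((continuous_truncPow hβ).stronglyMeasurableAtFilter _ _) (continuous_truncPow hβ).continuousAt

lemma deriv_truncPrim (hβ : 0 ≤ β) : deriv (truncPrim L β) = truncPow L β :=
  funext fun t => (hasDerivAt_truncPrim hβ t).deriv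

lemma contDiff_truncPrim (hβ : 0 ≤ β) : ContDiff ℝ 1 (truncPrim L β) :=
  contDiff_one_iff_deriv.2 ⟨fun t => (hasDerivAt_truncPrim hβ t).differentiableAt,
    by rw [deriv_truncPrim hβ]; exact continuous_truncPow hβ⟩

lemma abs_deriv_truncPrim_le (hL : 0 ≤ L) (hβ : 0 ≤ β) (t : ℝ) :
    |deriv (truncPrim L β) t| ≤ L ^ β := by
  rw [deriv_truncPrim hβ, abs_of_nonneg (truncPow_nonneg hL t)]
  exact truncPow_le hL hβ t

lemma truncPrim_neg (t : ℝ) : truncPrim L β (-t) = -truncPrim L β t := by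
  have h := intervalIntegral.integral_comp_neg (a := 0) (b := t) (fun s => truncPow L β s)
  rw [neg_zero] at h
  rw [truncPrim, truncPrim, intervalIntegral.integral_symm, ← h]
  simp [truncPow]

lemma truncPrim_nonneg (hL : 0 ≤ L) {t : ℝ} (ht : 0 ≤ t) : 0 ≤ truncPrim L β t :=
  intervalIntegral.integral_nonneg ht fun s _ => truncPow_nonneg hL s

lemma abs_truncPrim (hL : 0 ≤ L) (t : ℝ) : |truncPrim L β t| = truncPrim L β |t| := by
  rcases le_total 0 t with ht | ht
  · rw [abs_of_nonneg ht, abs_of_nonneg (truncPrim_nonneg hL ht)]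
  · rw [abs_of_nonpos ht, truncPrim_neg, abs_of_nonpos]
    have := truncPrim_nonneg (β := β) hL (neg_nonneg.2 ht)
    rw [truncPrim_neg] at this
    linarith

lemma abs_truncPrim_le (hL : 0 ≤ L) (hβ : 0 ≤ β) (t : ℝ) :
    |truncPrim L β t| ≤ |t| * truncPow L β t := by
  rw [abs_truncPrim hL, ← truncPow_abs]
  have ht := abs_nonneg t
  set r := |t|
  have h := intervalIntegral.integral_mono_on (μ := volume) (a := 0) (b := r) (g := fun _ => truncPow L β r) ht
    ((continuous_truncPow (L := L) hβ).intervalIntegrable _ _)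
    (continuous_const.intervalIntegrable _ _) fun s hs => truncPow_mono hL hβ (by
      rw [abs_of_nonneg hs.1, abs_of_nonneg ht]; exact hs.2)
  simpa [truncPrim] using h

/-- With `r = |t|`, the integral over `[r/2, r]` alone suffices: there the integrand is at least its
value at `r/2`, and halving the argument costs at most a factor `2^β`, whatever `L` is. -/
lemma abs_mul_truncPow_le (hL : 0 ≤ L) (hβ : 0 ≤ β) (t : ℝ) :
    |t| * truncPow L β t ≤ 2 ^ (1 + β) * |truncPrim L β t| := by
  rw [abs_truncPrim hL, ← truncPow_abs]
  have ht := abs_nonneg t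
  set r := |t|
  have hc := continuous_truncPow (L := L) hβ
  have hsplit : truncPrim L β (r / 2) + ∫ s in (r / 2)..r, truncPow L β s = truncPrim L β r :=
    intervalIntegral.integral_add_adjacent_intervals (hc.intervalIntegrable _ _)
      (hc.intervalIntegrable _ _)
  have hlow := intervalIntegral.integral_mono_on (μ := volume) (a := r / 2) (b := r)
    (f := fun _ => truncPow L β (r / 2)) (by linarith)
    (continuous_const.intervalIntegrable _ _) (hc.intervalIntegrable _ _)
    fun s hs => truncPow_mono hL hβ (by
      rw [abs_of_nonneg (by linarith [hs.1]), abs_of_nonneg (by linarith [hs.1])]; exact hs.1)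
  rw [intervalIntegral.integral_const, smul_eq_mul] at hlow
  have hhalf : truncPow L β r ≤ 2 ^ β * truncPow L β (r / 2) := by
    rw [truncPow, truncPow, ← Real.mul_rpow (by norm_num) (le_min (abs_nonneg _) hL)]
    refine Real.rpow_le_rpow (le_min (abs_nonneg _) hL) ?_ hβ
    rw [abs_of_nonneg ht, abs_of_nonneg (by linarith)]
    rcases le_total (r / 2) L with h | h
    · rw [min_eq_left h]; linarith [min_le_left r L]
    · rw [min_eq_right h]; linarith [min_le_right r L]
  have h0 := truncPrim_nonneg (β := β) hL (by linarith : 0 ≤ r / 2)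
  have h1 : r / 2 * truncPow L β (r / 2) ≤ truncPrim L β r := by
    have : (r - r / 2) = r / 2 := by ring
    rw [this] at hlow
    linarith
  have h2 : (0 : ℝ) ≤ 2 ^ β := by positivity
  rw [Real.rpow_add (by norm_num), Real.rpow_one]
  calc r * truncPow L β r ≤ r * (2 ^ β * truncPow L β (r / 2)) := by gcongr
    _ = 2 * 2 ^ β * (r / 2 * truncPow L β (r / 2)) := by ring
    _ ≤ 2 * 2 ^ β * truncPrim L β r := by gcongr

/-- The integrand on the left is the `p`-th power of `truncPow L β`; by monotonicity, `p - 1` of its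
factors can be frozen at the endpoint. -/
lemma abs_truncPrim_mul_le (hL : 0 ≤ L) (hβ : 0 ≤ β) {p : ℝ} (hp : 1 < p) (t : ℝ) :
    |truncPrim L (β * p) t| ≤ |truncPrim L β t| * truncPow L β t ^ (p - 1) := by
  have hp0 : 0 ≤ β * p := by positivity
  rw [abs_truncPrim hL, abs_truncPrim hL, ← truncPow_abs]
  have ht := abs_nonneg t
  set r := |t|
  have hc := continuous_truncPow (L := L) hβ
  have h := intervalIntegral.integral_mono_on (μ := volume) (a := 0) (b := r)
    (g := fun s => truncPow L β s * truncPow L β r ^ (p - 1)) ht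
    ((continuous_truncPow (L := L) hp0).intervalIntegrable _ _)
    ((hc.mul continuous_const).intervalIntegrable _ _) fun s hs => by
      have hs0 := truncPow_nonneg (β := β) hL s
      rw [← truncPow_rpow hL]
      have e : truncPow L β s ^ p = truncPow L β s * truncPow L β s ^ (p - 1) := by
        nth_rewrite 2 [← Real.rpow_one (truncPow L β s)]
        rw [← Real.rpow_add_of_nonneg hs0 zero_le_one (by linarith)]
        congr 1; ring
      rw [e]
      refine mul_le_mul_of_nonneg_left (Real.rpow_le_rpow hs0 (truncPow_mono hL hβ ?_)
        (by linarith)) hs0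
      rw [abs_of_nonneg hs.1, abs_of_nonneg ht]; exact hs.2
  rwa [intervalIntegral.integral_mul_const] at h

end TruncatedPower

/-! ### Splitting the potential, and elementary inequalities. -/

section Absorption

variable {α : Type*} {m : MeasurableSpace α} {μ : Measure α}

/-- A potential `a ∈ L^t` is bounded up to an arbitrarily small form perturbation. -/
lemma exists_integral_abs_mul_rpow_le {p q t : ℝ} (hp : 0 < p)
    (ht : t.HolderConjugate (q / p)) {a : α → ℝ} (ha : MemLp a (ENNReal.ofReal t) μ) {ε : ℝ}
    (hε : 0 < ε) :
    ∃ k : ℝ, 0 ≤ k ∧ ∀ u : α → ℝ, MemLp u (ENNReal.ofReal p) μ → MemLp u (ENNReal.ofReal q) μ →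
      Integrable (fun x => |a x| * |u x| ^ p) μ ∧
      ∫ x, |a x| * |u x| ^ p ∂μ ≤ k * ∫ x, |u x| ^ p ∂μ + ε * (∫ x, |u x| ^ q ∂μ) ^ (p / q) := by
  have ht0 : 0 < t := ht.pos
  have ht0' : ENNReal.ofReal t ≠ 0 := by simpa using ht0
  -- The excess of `|a|` over height `n` tends to `0` in `L^t` by dominated convergence. A height
  -- with excess below `ε` becomes the constant `k`.
  set b : ℕ → α → ℝ := fun n x => max (|a x| - n) 0 with hb
  have hb0 : ∀ n x, 0 ≤ b n x := fun n x => le_max_right _ _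
  have hba : ∀ n x, b n x ≤ |a x| := fun n x => max_le (by simp) (abs_nonneg _)
  have hbm : ∀ n, AEStronglyMeasurable (b n) μ := fun n =>
    ((continuous_abs.sub continuous_const).max continuous_const).comp_aestronglyMeasurable ha.1
  have hbL : ∀ n, MemLp (b n) (ENNReal.ofReal t) μ := fun n =>
    ha.of_le (hbm n) (Eventually.of_forall fun x => by
      rw [Real.norm_of_nonneg (hb0 n x)]; exact hba n x)
  have hlim : Tendsto (fun n => ∫ x, b n x ^ t ∂μ) atTop (𝓝 (∫ _, (0 : ℝ) ∂μ)) := by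
    refine tendsto_integral_of_dominated_convergence (fun x => |a x| ^ t)
      (fun n => ((hbm n).aemeasurable.pow_const t).aestronglyMeasurable) ?_ (fun n => ?_) ?_
    · have := ha.integrable_norm_rpow ht0' ENNReal.ofReal_ne_top
      rwa [ENNReal.toReal_ofReal ht0.le] at this
    · refine Eventually.of_forall fun x => ?_
      rw [Real.norm_of_nonneg (Real.rpow_nonneg (hb0 n x) _)]
      exact Real.rpow_le_rpow (hb0 n x) (hba n x) ht0.le
    · refine Eventually.of_forall fun x => tendsto_const_nhds.congr' ?_
      filter_upwards [eventually_ge_atTop ⌈|a x|⌉₊] with n hn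
      have : |a x| ≤ n := (Nat.le_ceil _).trans (by exact_mod_cast hn)
      rw [hb]
      simp only
      rw [max_eq_right (by linarith), Real.zero_rpow ht0.ne']
  rw [integral_zero] at hlim
  have hlim2 : Tendsto (fun n => (∫ x, b n x ^ t ∂μ) ^ (1 / t)) atTop (𝓝 0) := by
    have := hlim.rpow_const (p := 1 / t) (Or.inr (by positivity))
    rwa [Real.zero_rpow (by positivity)] at this
  obtain ⟨n, hn⟩ := (hlim2.eventually (gt_mem_nhds hε)).exists
  refine ⟨n, by positivity, fun u hup huq => ?_⟩
  have hu1 : Integrable (fun x => |u x| ^ p) μ := by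
    have := hup.integrable_norm_rpow (by simpa using hp) ENNReal.ofReal_ne_top
    rwa [ENNReal.toReal_ofReal hp.le] at this
  have hu2 : MemLp (fun x => |u x| ^ p) (ENNReal.ofReal (q / p)) μ :=
    memLp_norm_rpow_of_div hp huq
  have htri : (ENNReal.ofReal t).HolderTriple (ENNReal.ofReal (q / p)) 1 := ht.ennrealOfReal
  have hint : Integrable (fun x => |a x| * |u x| ^ p) μ := ha.norm.integrable_mul hu2
  have hintb : Integrable (fun x => b n x * |u x| ^ p) μ := (hbL n).integrable_mul hu2
  refine ⟨hint, ?_⟩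
  have hholder := integral_mul_le_Lp_mul_Lq_of_nonneg ht (μ := μ) (f := b n)
    (g := fun x => |u x| ^ p) (Eventually.of_forall (hb0 n))
    (Eventually.of_forall fun x => by positivity) (hbL n) hu2
  have hpow : ∀ x, (|u x| ^ p) ^ (q / p) = |u x| ^ q := fun x => by
    rw [← Real.rpow_mul (abs_nonneg _), mul_div_cancel₀ _ hp.ne']
  simp_rw [hpow] at hholder
  rw [one_div_div] at hholder
  calc ∫ x, |a x| * |u x| ^ p ∂μ ≤ ∫ x, (n * |u x| ^ p + b n x * |u x| ^ p) ∂μ := by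
        refine integral_mono hint ((hu1.const_mul _).add hintb) fun x => ?_
        simp only
        rw [← add_mul]
        gcongr
        linarith [le_max_left (|a x| - n) 0]
    _ = n * ∫ x, |u x| ^ p ∂μ + ∫ x, b n x * |u x| ^ p ∂μ := by
        rw [integral_add (hu1.const_mul _) hintb, integral_const_mul]
    _ ≤ n * ∫ x, |u x| ^ p ∂μ + ε * (∫ x, |u x| ^ q ∂μ) ^ (p / q) := by
        gcongr
        refine hholder.trans (mul_le_mul_of_nonneg_right hn.le ?_)
        exact Real.rpow_nonneg (integral_nonneg fun x => by positivity) _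

/-- Young's inequality with a crude constant, by comparing `x` with `2 p y`: in each case one term
on the right suffices. -/
lemma mul_rpow_sub_one_mul_le {p x y : ℝ} (hp : 1 < p) (hx : 0 ≤ x) (hy : 0 ≤ y) :
    p * (x ^ (p - 1) * y) ≤ x ^ p / 2 + (2 * p) ^ p * y ^ p := by
  have hsplit : ∀ z : ℝ, 0 ≤ z → z ^ p = z ^ (p - 1) * z := fun z hz => by
    nth_rewrite 3 [← Real.rpow_one z]
    rw [← Real.rpow_add_of_nonneg hz (by linarith) zero_le_one]
    congr 1; ring
  have h1 : 0 ≤ x ^ (p - 1) := Real.rpow_nonneg hx _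
  have h2 : 0 ≤ (2 * p) ^ p * y ^ p := by positivity
  have h3 : 0 ≤ x ^ p := Real.rpow_nonneg hx _
  rcases le_total (2 * p * y) x with h | h
  · have : p * (x ^ (p - 1) * y) ≤ x ^ p / 2 := by
      rw [hsplit x hx]
      have := mul_le_mul_of_nonneg_left h h1
      linarith
    linarith
  · have h4 : x ^ (p - 1) ≤ (2 * p * y) ^ (p - 1) := Real.rpow_le_rpow hx h (by linarith)
    have h5 : (2 * p) ^ p * y ^ p = (2 * p * y) ^ (p - 1) * (2 * p * y) := by
      rw [← Real.mul_rpow (by positivity) hy, hsplit _ (by positivity)]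
    have h6 := mul_le_mul_of_nonneg_right h4 (by positivity : 0 ≤ p * y)
    have h7 : 0 ≤ x ^ (p - 1) * (p * y) := by positivity
    linarith

lemma add_rpow_le_two_rpow_mul {p x y : ℝ} (hp : 0 ≤ p) (hx : 0 ≤ x) (hy : 0 ≤ y) :
    (x + y) ^ p ≤ 2 ^ p * (x ^ p + y ^ p) := by
  have h1 : x + y ≤ 2 * max x y := by linarith [le_max_left x y, le_max_right x y]
  calc (x + y) ^ p ≤ (2 * max x y) ^ p := Real.rpow_le_rpow (by positivity) h1 hp
    _ = 2 ^ p * max x y ^ p := Real.mul_rpow (by norm_num) (le_max_of_le_left hx)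
    _ ≤ 2 ^ p * (x ^ p + y ^ p) := by
        gcongr
        rcases max_choice x y with h | h <;> rw [h]
        · linarith [Real.rpow_nonneg hy p]
        · linarith [Real.rpow_nonneg hx p]

end Absorption

/-! ### The energy estimate, uniform in truncation and cutoff. -/

section Energy

open scoped ENNReal NNReal

variable {N : ℕ}

lemma gradient_rpow {E : Type*} [NormedAddCommGroup E] [InnerProductSpace ℝ E] [CompleteSpace E]
    {η : E → ℝ} {p : ℝ} (hp : 1 ≤ p) (hη : Differentiable ℝ η) (x : E) :
    ∇ (fun y => η y ^ p) x = (p * η x ^ (p - 1)) • ∇ η x := by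
  refine HasGradientAt.gradient ?_
  have h1 := (hη x).hasGradientAt
  rw [hasGradientAt_iff_hasFDerivAt] at h1 ⊢
  have h2 := (Real.hasDerivAt_rpow_const (x := η x) (p := p) (Or.inr hp)).comp_hasFDerivAt x h1
  exact h2.congr_fderiv (by simp)

lemma contDiff_rpow_of_one_le {E : Type*} [NormedAddCommGroup E] [NormedSpace ℝ E]
    {η : E → ℝ} {p : ℝ} (hp : 1 ≤ p) (hη : ContDiff ℝ 1 η) : ContDiff ℝ 1 (fun y => η y ^ p) := by
  have : ContDiff ℝ ((1 : ℕ) : WithTop ℕ∞) fun t : ℝ => t ^ p :=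
    Real.contDiff_rpow_const_of_le (by simpa using hp)
  exact (by exact_mod_cast this : ContDiff ℝ 1 fun t : ℝ => t ^ p).comp hη

variable {p q β L M : ℝ} {v H a η : EuclideanSpace ℝ (Fin N) → ℝ}
  {G : EuclideanSpace ℝ (Fin N) → EuclideanSpace ℝ (Fin N)}

lemma inner_flux_eq (hp : 1 < p) (w : EuclideanSpace ℝ (Fin N)) {s : ℝ} (hs : 0 ≤ s) :
    inner ℝ (‖w‖ ^ (p - 2) • w) (s ^ p • w) = (s * ‖w‖) ^ p := by
  rw [inner_smul_left, inner_smul_right, real_inner_self_eq_norm_sq,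
    Real.mul_rpow hs (norm_nonneg _)]
  simp only [conj_trivial]
  rcases eq_or_ne w 0 with rfl | hw
  · simp [Real.zero_rpow (by linarith : p ≠ 0)]
  · have hpos : 0 < ‖w‖ := norm_pos_iff.2 hw
    have : ‖w‖ ^ p = ‖w‖ ^ (p - 2) * ‖w‖ ^ 2 := by
      rw [← Real.rpow_natCast, ← Real.rpow_add hpos]; congr 1; push_cast; ring
    rw [this]; ring

/-- Pointwise control of the commutator term between cutoff and gradient. -/
lemma abs_commutator_le (hp : 1 < p) (hβ : 0 ≤ β) (hL : 0 ≤ L) {s t : ℝ} (hs : 0 ≤ s)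
    (w z : EuclideanSpace ℝ (Fin N)) :
    |truncPrim L (β * p) t * inner ℝ (‖w‖ ^ (p - 2) • w) ((p * s ^ (p - 1)) • z)| ≤
      (s * truncPow L β t * ‖w‖) ^ p / 2 + (2 * p) ^ p * (|truncPrim L β t| * ‖z‖) ^ p := by
  have hm := truncPow_nonneg (β := β) hL t
  refine le_trans ?_ (mul_rpow_sub_one_mul_le hp (by positivity : 0 ≤ s * truncPow L β t * ‖w‖)
    (by positivity : 0 ≤ |truncPrim L β t| * ‖z‖))
  have hs' : 0 ≤ s ^ (p - 1) := Real.rpow_nonneg hs _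
  have h1 : |inner ℝ (‖w‖ ^ (p - 2) • w) ((p * s ^ (p - 1)) • z)| ≤
      ‖w‖ ^ (p - 1) * (p * s ^ (p - 1) * ‖z‖) := by
    refine (abs_real_inner_le_norm _ _).trans (le_of_eq ?_)
    rw [norm_rpow_sub_two_smul hp, norm_smul, Real.norm_of_nonneg (by positivity)]
  rw [abs_mul]
  calc _ ≤ (|truncPrim L β t| * truncPow L β t ^ (p - 1)) *
        (‖w‖ ^ (p - 1) * (p * s ^ (p - 1) * ‖z‖)) :=
        mul_le_mul (abs_truncPrim_mul_le hL hβ hp t) h1 (abs_nonneg _)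
          (mul_nonneg (abs_nonneg _) (Real.rpow_nonneg hm _))
    _ = _ := by
        rw [Real.mul_rpow (by positivity) (norm_nonneg _), Real.mul_rpow hs hm]; ring

/-- Pointwise control of the right-hand side tested with `η ^ p * ψ(v)`. -/
lemma abs_rhs_mul_le (hp : 1 < p) (hβ : 0 ≤ β) (hL : 0 ≤ L) (hM : 0 ≤ M) {s t h A : ℝ}
    (hs : 0 ≤ s) (hh : |h| ≤ (M + A) * |t| ^ (p - 1)) :
    |h * (s ^ p * truncPrim L (β * p) t)| ≤
      (2 ^ (1 + β)) ^ (p - 1) * ((M + |A|) * |s * truncPrim L β t| ^ p) := by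
  have hm := truncPow_nonneg (β := β) hL t
  have hg := abs_nonneg (truncPrim L β t)
  have hp1 : 0 ≤ p - 1 := by linarith
  have hsp : 0 ≤ s ^ p := Real.rpow_nonneg hs _
  have hh' : |h| ≤ (M + |A|) * |t| ^ (p - 1) :=
    hh.trans (mul_le_mul_of_nonneg_right (by linarith [le_abs_self A]) (by positivity))
  have hsplit : |truncPrim L β t| ^ p = |truncPrim L β t| ^ (p - 1) * |truncPrim L β t| := by
    nth_rewrite 3 [← Real.rpow_one |truncPrim L β t|]
    rw [← Real.rpow_add_of_nonneg hg (by linarith) zero_le_one]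
    congr 1; ring
  have hcore : |t| ^ (p - 1) * truncPow L β t ^ (p - 1) ≤
      (2 ^ (1 + β)) ^ (p - 1) * |truncPrim L β t| ^ (p - 1) := by
    rw [← Real.mul_rpow (abs_nonneg _) hm, ← Real.mul_rpow (by positivity) hg]
    exact Real.rpow_le_rpow (by positivity) (abs_mul_truncPow_le hL hβ t) hp1
  rw [abs_mul, abs_mul, abs_mul, abs_of_nonneg hsp, abs_of_nonneg hs, Real.mul_rpow hs hg]
  calc |h| * (s ^ p * |truncPrim L (β * p) t|)
      ≤ ((M + |A|) * |t| ^ (p - 1)) *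
        (s ^ p * (|truncPrim L β t| * truncPow L β t ^ (p - 1))) := by
        gcongr
        exact abs_truncPrim_mul_le hL hβ hp t
    _ = (M + |A|) * s ^ p * |truncPrim L β t| * (|t| ^ (p - 1) * truncPow L β t ^ (p - 1)) := by
        ring
    _ ≤ (M + |A|) * s ^ p * |truncPrim L β t| *
        ((2 ^ (1 + β)) ^ (p - 1) * |truncPrim L β t| ^ (p - 1)) := by gcongr
    _ = _ := by rw [hsplit]; ring

lemma integrable_norm_rpow_ofReal {α F : Type*} {m : MeasurableSpace α} {μ : Measure α}
    [NormedAddCommGroup F] {f : α → F} {r : ℝ} (hr : 0 < r) (hf : MemLp f (ENNReal.ofReal r) μ) :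
    Integrable (fun x => ‖f x‖ ^ r) μ := by
  have := hf.integrable_norm_rpow (by simpa using hr) ENNReal.ofReal_ne_top
  rwa [ENNReal.toReal_ofReal hr.le] at this

/-- `v` has weak gradient `G`, locally in `L^p`, and solves `-div (|G|^(p-2) G) = H` weakly, with
`H` locally in the dual of `L^q`. -/
structure IsFiniteEnergySolution (p q : ℝ) (v : EuclideanSpace ℝ (Fin N) → ℝ)
    (G : EuclideanSpace ℝ (Fin N) → EuclideanSpace ℝ (Fin N)) (H : EuclideanSpace ℝ (Fin N) → ℝ) :
    Prop where
  hasWeakGradient : HasWeakGradient v G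
  memLpLoc : MemLpLoc v (ENNReal.ofReal p)
  memLpLoc_gradient : MemLpLoc G (ENNReal.ofReal p)
  memLpLoc_rhs : MemLpLoc H (ENNReal.ofReal (q / (q - 1)))
  weakForm : ∀ φ : EuclideanSpace ℝ (Fin N) → ℝ, ContDiff ℝ ∞ φ → HasCompactSupport φ →
    ∫ x, inner ℝ (‖G x‖ ^ (p - 2) • G x) (∇ φ x) = ∫ x, H x * φ x

variable (N) in
/-- The truncated energy estimate, uniform in the truncation level and in the cutoff. -/
lemma exists_truncated_energy_bound (hp : 1 < p) (hpN : p < (N : ℝ)) (hq : 1 < q)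
    (hpq : q⁻¹ = p⁻¹ - (N : ℝ)⁻¹) (hβ : 0 ≤ β) (hM : 0 ≤ M)
    (ha : MemLp a (ENNReal.ofReal ((N : ℝ) / p)) volume) :
    ∃ C : ℝ, 0 ≤ C ∧ ∀ (v H : EuclideanSpace ℝ (Fin N) → ℝ)
      (G : EuclideanSpace ℝ (Fin N) → EuclideanSpace ℝ (Fin N)), IsFiniteEnergySolution p q v G H →
      ∀ η : EuclideanSpace ℝ (Fin N) → ℝ, ContDiff ℝ 1 η → HasCompactSupport η → (∀ x, 0 ≤ η x) →
      (∀ᵐ x, η x ≠ 0 → |H x| ≤ (M + a x) * |v x| ^ (p - 1)) → ∀ L : ℝ, 0 ≤ L →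
      Integrable (fun x => |truncPrim L β (v x)| ^ p * (η x ^ p + ‖∇ η x‖ ^ p)) ∧
      Integrable (fun x => |η x * truncPrim L β (v x)| ^ q) ∧
      (∫ x, |η x * truncPrim L β (v x)| ^ q) ^ (p / q) ≤
        C * ∫ x, |truncPrim L β (v x)| ^ p * (η x ^ p + ‖∇ η x‖ ^ p) := by
  have hp0 : 0 < p := by linarith
  have hq0 : 0 < q := by linarith
  have hN0 : (0 : ℝ) < N := by linarith
  have hNpos : 0 < N := by exact_mod_cast hN0
  -- Criticality of `L^(N/p)`: the Sobolev relation reads `p/N + p/q = 1`.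
  have ht : ((N : ℝ) / p).HolderConjugate (q / p) := by
    refine ⟨?_, by positivity, by positivity⟩
    rw [inv_div, inv_div, div_eq_mul_inv p q, hpq]
    field_simp
    ring
  obtain ⟨S, hS⟩ := exists_eLpNorm_cutoff_mul_comp_le (N := N) hp.le hNpos hq0 hpq
  set T : ℝ := (S : ℝ) ^ p * 2 ^ p with hT
  have hT0 : 0 ≤ T := by positivity
  set c : ℝ := (2 ^ (1 + β)) ^ (p - 1) with hc
  have hc0 : 0 < c := by positivity
  -- The Sobolev bound `W ≤ T (A + Y)` turns `c ε W` into at most `(A + Y)/4`. Together with the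
  -- `A/2` lost to the commutator, a quarter of `A` survives.
  set ε : ℝ := 1 / (4 * c * (T + 1)) with hε
  have hε0 : 0 < ε := by positivity
  have hεT : c * ε * T ≤ 1 / 4 := by
    rw [hε]
    have : c * (1 / (4 * c * (T + 1))) * T = 1 / 4 * (T / (T + 1)) := by
      field_simp
    rw [this]
    have : T / (T + 1) ≤ 1 := (div_le_one (by positivity)).2 (by linarith)
    linarith
  obtain ⟨k, hk0, hk⟩ := exists_integral_abs_mul_rpow_le hp0 ht ha hε0
  set D : ℝ := (2 * p) ^ p + 1 / 4 + c * (M + k) with hD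
  have hD0 : 0 ≤ D := by positivity
  refine ⟨T * (4 * D + 1), by positivity, ?_⟩
  rintro v H G ⟨hw, hv, hG, hH, hweak⟩ η hη hηs hη0 hbd L hL
  have hvq := memLpLoc_of_hasWeakGradient hp.le hNpos hq0 hpq hw hv hG
  have hβp : 0 ≤ β * p := by positivity
  have hgC := contDiff_truncPrim (L := L) hβ
  have hgΛ := abs_deriv_truncPrim_le (L := L) hL hβ
  have hψC := contDiff_truncPrim (L := L) hβp
  have hψΛ := abs_deriv_truncPrim_le (L := L) hL hβp
  set g : EuclideanSpace ℝ (Fin N) → ℝ := fun x => truncPrim L β (v x) with hg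
  set ψ : EuclideanSpace ℝ (Fin N) → ℝ := fun x => truncPrim L (β * p) (v x) with hψ
  set mm : EuclideanSpace ℝ (Fin N) → ℝ := fun x => truncPow L β (v x) with hmm
  have hmm0 : ∀ x, 0 ≤ mm x := fun x => truncPow_nonneg hL _
  have hup := memLp_cutoff_mul_comp hη.continuous hηs hgC hgΛ truncPrim_zero hv
  have huq := memLp_cutoff_mul_comp hη.continuous hηs hgC hgΛ truncPrim_zero hvq
  have iU : Integrable fun x => |η x * g x| ^ p := integrable_norm_rpow_ofReal hp0 hup
  have iW : Integrable fun x => |η x * g x| ^ q := integrable_norm_rpow_ofReal hq0 huq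
  -- Finiteness of `A`, without which it could not be absorbed, comes from the truncation: `truncPow
  -- L β` is bounded by `L^β`.
  have iA : Integrable fun x => (η x * mm x * ‖G x‖) ^ p := by
    have h := integrable_norm_rpow_ofReal hp0
      (memLp_cutoff_smul hη.continuous hηs hgC hgΛ hv hG)
    refine h.congr (Eventually.of_forall fun x => ?_)
    simp only
    rw [norm_smul, deriv_truncPrim hβ, Real.norm_of_nonneg (mul_nonneg (hη0 x) (hmm0 x))]
  have iY : Integrable fun x => (|g x| * ‖∇ η x‖) ^ p := by
    have h := integrable_norm_rpow_ofReal hp0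
      (memLp_comp_smul_gradient hη hηs hgC hgΛ truncPrim_zero hv)
    refine h.congr (Eventually.of_forall fun x => ?_)
    simp only
    rw [norm_smul, Real.norm_eq_abs]
  have hBeq : ∀ x, |g x| ^ p * (η x ^ p + ‖∇ η x‖ ^ p) =
      |η x * g x| ^ p + (|g x| * ‖∇ η x‖) ^ p := fun x => by
    rw [abs_mul, abs_of_nonneg (hη0 x), Real.mul_rpow (hη0 x) (abs_nonneg _),
      Real.mul_rpow (abs_nonneg _) (norm_nonneg _)]
    ring
  have iB : Integrable fun x => |g x| ^ p * (η x ^ p + ‖∇ η x‖ ^ p) :=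
    (iU.add iY).congr (Eventually.of_forall fun x => (hBeq x).symm)
  refine ⟨iB, iW, ?_⟩
  obtain ⟨iaU, haU⟩ := hk _ hup huq
  have hB : ∫ x, |g x| ^ p * (η x ^ p + ‖∇ η x‖ ^ p) =
      (∫ x, |η x * g x| ^ p) + ∫ x, (|g x| * ‖∇ η x‖) ^ p := by
    rw [← integral_add iU iY]
    exact integral_congr_ae (Eventually.of_forall hBeq)
  set A := ∫ x, (η x * mm x * ‖G x‖) ^ p with hA
  set Y := ∫ x, (|g x| * ‖∇ η x‖) ^ p with hY
  set U := ∫ x, |η x * g x| ^ p with hU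
  set W := (∫ x, |η x * g x| ^ q) ^ (p / q) with hW
  have hA0 : 0 ≤ A := integral_nonneg fun x =>
    Real.rpow_nonneg (mul_nonneg (mul_nonneg (hη0 x) (hmm0 x)) (norm_nonneg _)) _
  have hY0 : 0 ≤ Y := integral_nonneg fun x => by positivity
  have hU0 : 0 ≤ U := integral_nonneg fun x => by positivity
  have hsob : W ≤ T * (A + Y) := by
    have hI0 : 0 ≤ ∫ x, |η x * g x| ^ q := integral_nonneg fun x => by positivity
    have hJ0 : 0 ≤ ∫ x, ‖cutoffGradient η (truncPrim L β) v G x‖ ^ p :=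
      integral_nonneg fun x => by positivity
    have h1 := hS v G hw hv hG η hη hηs _ _ hgC hgΛ truncPrim_zero
    have hΦ := memLp_cutoffGradient hη hηs hgC hgΛ truncPrim_zero hv hG
    rw [huq.eLpNorm_eq_integral_rpow_norm (by simpa using hq0) ENNReal.ofReal_ne_top,
      hΦ.eLpNorm_eq_integral_rpow_norm (by simpa using hp0) ENNReal.ofReal_ne_top,
      ENNReal.toReal_ofReal hq0.le, ENNReal.toReal_ofReal hp0.le, ← ENNReal.ofReal_coe_nnreal,
      ← ENNReal.ofReal_mul (by positivity),
      ENNReal.ofReal_le_ofReal_iff (mul_nonneg S.coe_nonneg (Real.rpow_nonneg hJ0 _))] at h1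
    have h2 := Real.rpow_le_rpow (Real.rpow_nonneg hI0 q⁻¹) h1 hp0.le
    rw [Real.mul_rpow S.coe_nonneg (Real.rpow_nonneg hJ0 _), ← Real.rpow_mul hI0, ← Real.rpow_mul hJ0,
      inv_mul_cancel₀ hp0.ne', Real.rpow_one] at h2
    have h3 : ∫ x, ‖cutoffGradient η (truncPrim L β) v G x‖ ^ p ≤ 2 ^ p * (A + Y) := by
      rw [hA, hY, ← integral_add iA iY, ← integral_const_mul]
      refine integral_mono (integrable_norm_rpow_ofReal hp0 hΦ) ((iA.add iY).const_mul _)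
        fun x => ?_
      refine (Real.rpow_le_rpow (norm_nonneg _) ?_ hp0.le).trans (add_rpow_le_two_rpow_mul hp0.le
        (mul_nonneg (mul_nonneg (hη0 x) (hmm0 x)) (norm_nonneg _))
        (mul_nonneg (abs_nonneg (g x)) (norm_nonneg (∇ η x))))
      refine (norm_add_le _ _).trans (le_of_eq ?_)
      rw [norm_smul, norm_smul, deriv_truncPrim hβ,
        Real.norm_of_nonneg (mul_nonneg (hη0 x) (hmm0 x)), Real.norm_eq_abs]
    calc W = (∫ x, |η x * g x| ^ q) ^ (q⁻¹ * p) := by rw [hW, div_eq_inv_mul]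
      _ ≤ (S : ℝ) ^ p * ∫ x, ‖cutoffGradient η (truncPrim L β) v G x‖ ^ p := h2
      _ ≤ (S : ℝ) ^ p * (2 ^ p * (A + Y)) := by gcongr
      _ = T * (A + Y) := by rw [hT]; ring
  have hconjp : (p / (p - 1)).HolderConjugate p :=
    (Real.HolderConjugate.conjExponent hp).symm
  have hconjq : (q / (q - 1)).HolderConjugate q :=
    (Real.HolderConjugate.conjExponent hq).symm
  have hθC := contDiff_rpow_of_one_le hp.le hη
  have hθs : HasCompactSupport fun x => η x ^ p :=
    hηs.comp_left (g := fun t : ℝ => t ^ p) (Real.zero_rpow hp0.ne')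
  -- The derivative of `truncPrim L (β * p)` is `truncPow L β` to the power `p`, so the main term of
  -- this test is exactly `A`.
  have htest := weakForm_cutoff_mul_comp hconjp hconjq (memLpLoc_rpow_sub_two_smul hp hG) hH hweak
    hw hv hvq hG hθC hθs hψC hψΛ truncPrim_zero
  set R : EuclideanSpace ℝ (Fin N) → ℝ := fun x =>
    ψ x * inner ℝ (‖G x‖ ^ (p - 2) • G x) ((p * η x ^ (p - 1)) • ∇ η x) with hR
  have hRle : ∀ x, |R x| ≤ (η x * mm x * ‖G x‖) ^ p / 2 +
      (2 * p) ^ p * (|g x| * ‖∇ η x‖) ^ p := fun x =>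
    abs_commutator_le hp hβ hL (hη0 x) (G x) (∇ η x)
  have iBd : Integrable fun x => (η x * mm x * ‖G x‖) ^ p / 2 +
      (2 * p) ^ p * (|g x| * ‖∇ η x‖) ^ p := (iA.div_const 2).add (iY.const_mul _)
  have hvm : AEStronglyMeasurable v volume := hw.1.aestronglyMeasurable
  have hGm : AEStronglyMeasurable G volume := hw.2.1.aestronglyMeasurable
  have hRm : AEStronglyMeasurable R volume :=
    (hψC.continuous.comp_aestronglyMeasurable hvm).mul
      (((hGm.norm.aemeasurable.pow_const _).aestronglyMeasurable.smul hGm).inner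
        ((continuous_const.mul (hη.continuous.rpow_const fun _ => Or.inr
          (by linarith))).smul (continuous_gradient hη)).aestronglyMeasurable)
  have iR : Integrable R := iBd.mono' hRm (Eventually.of_forall hRle)
  have hlhs : ∫ x, inner ℝ (‖G x‖ ^ (p - 2) • G x)
      (cutoffGradient (fun x => η x ^ p) (truncPrim L (β * p)) v G x) = A + ∫ x, R x := by
    rw [hA, ← integral_add iA iR]
    refine integral_congr_ae (Eventually.of_forall fun x => ?_)
    simp only [cutoffGradient]
    rw [inner_add_right, deriv_truncPrim hβp, ← truncPow_rpow hL,
      ← Real.mul_rpow (hη0 x) (hmm0 x), inner_flux_eq hp _ (mul_nonneg (hη0 x) (hmm0 x)),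
      gradient_rpow hp.le (hη.differentiable one_ne_zero), inner_smul_right]
  have hR1 : -(A / 2 + (2 * p) ^ p * Y) ≤ ∫ x, R x := by
    have h1 := norm_integral_le_of_norm_le (f := R) iBd (Eventually.of_forall hRle)
    rw [integral_add (iA.div_const 2) (iY.const_mul _), integral_div, integral_const_mul] at h1
    exact (abs_le.1 h1).1
  have hrhs : ∫ x, H x * (η x ^ p * truncPrim L (β * p) (v x)) ≤
      c * (M * U + (k * U + ε * W)) := by
    have iF : Integrable fun x => c * (M * |η x * g x| ^ p + |a x| * |η x * g x| ^ p) :=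
      ((iU.const_mul M).add iaU).const_mul c
    have h1 : ‖∫ x, H x * (η x ^ p * truncPrim L (β * p) (v x))‖ ≤
        ∫ x, c * (M * |η x * g x| ^ p + |a x| * |η x * g x| ^ p) := by
      refine norm_integral_le_of_norm_le iF ?_
      filter_upwards [hbd] with x hx
      rw [← add_mul]
      rcases eq_or_ne (η x) 0 with h0 | h0
      · simp [h0, Real.zero_rpow hp0.ne']
      · exact abs_rhs_mul_le hp hβ hL hM (hη0 x) (hx h0)
    refine ((le_abs_self _).trans h1).trans ?_
    rw [integral_const_mul, integral_add (iU.const_mul M) iaU, integral_const_mul]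
    gcongr
  rw [hlhs] at htest
  have hεW : c * (ε * W) ≤ (A + Y) / 4 := by
    calc c * (ε * W) ≤ c * (ε * (T * (A + Y))) := by gcongr
      _ = (c * ε * T) * (A + Y) := by ring
      _ ≤ 1 / 4 * (A + Y) := by gcongr
      _ = (A + Y) / 4 := by ring
  have hAle : A ≤ 4 * (D * (U + Y)) := by
    have h1 : 0 ≤ ((2 * p) ^ p + 1 / 4) * U := by positivity
    have h2 : 0 ≤ c * (M + k) * Y := by positivity
    have h3 : D * (U + Y) = ((2 * p) ^ p + 1 / 4) * U + ((2 * p) ^ p + 1 / 4) * Y +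
        c * (M + k) * U + c * (M + k) * Y := by rw [hD]; ring
    have h4 : c * (M * U + (k * U + ε * W)) = c * (M + k) * U + c * (ε * W) := by ring
    rw [h3]
    linarith
  rw [hB]
  calc W ≤ T * (A + Y) := hsob
    _ ≤ T * (4 * (D * (U + Y)) + (U + Y)) := by gcongr; linarith
    _ = T * (4 * D + 1) * (U + Y) := by ring

end Energy

/-! ### Removing the truncation; local and global gain of integrability. -/

section Moser

open scoped ENNReal NNReal

variable {N : ℕ} {p q β M : ℝ} {a : EuclideanSpace ℝ (Fin N) → ℝ}

variable (N) in
/-- The Brezis-Kato estimate: the `L^(q (1 + β))` norm is controlled by the `L^(p (1 + β))` norm. -/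
lemma exists_lintegral_cutoff_le (hp : 1 < p) (hpN : p < (N : ℝ)) (hq : 1 < q)
    (hpq : q⁻¹ = p⁻¹ - (N : ℝ)⁻¹) (hβ : 0 ≤ β) (hM : 0 ≤ M)
    (ha : MemLp a (ENNReal.ofReal ((N : ℝ) / p)) volume) :
    ∃ C : ℝ≥0∞, C ≠ ⊤ ∧ ∀ (v H : EuclideanSpace ℝ (Fin N) → ℝ)
      (G : EuclideanSpace ℝ (Fin N) → EuclideanSpace ℝ (Fin N)), IsFiniteEnergySolution p q v G H →
      ∀ η : EuclideanSpace ℝ (Fin N) → ℝ, ContDiff ℝ 1 η → HasCompactSupport η → (∀ x, 0 ≤ η x) →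
      (∀ᵐ x, η x ≠ 0 → |H x| ≤ (M + a x) * |v x| ^ (p - 1)) →
      ∫⁻ x, (ENNReal.ofReal (η x) * ‖v x‖ₑ ^ (1 + β)) ^ q ≤
        (C * ∫⁻ x, ‖v x‖ₑ ^ (p * (1 + β)) * ENNReal.ofReal (η x ^ p + ‖∇ η x‖ ^ p)) ^ (q / p) := by
  have hp0 : 0 < p := by linarith
  have hq0 : 0 < q := by linarith
  obtain ⟨C, hC0, hC⟩ := exists_truncated_energy_bound N hp hpN hq hpq hβ hM ha
  set c : ℝ := 2 ^ (1 + β) with hc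
  have hc0 : 0 < c := by positivity
  refine ⟨ENNReal.ofReal (c ^ p * C), ENNReal.ofReal_ne_top, ?_⟩
  intro v H G hsol η hη hηs hη0 hbd
  have hvm : AEStronglyMeasurable v volume := hsol.hasWeakGradient.1.aestronglyMeasurable
  set J := ∫⁻ x, ‖v x‖ₑ ^ (p * (1 + β)) * ENNReal.ofReal (η x ^ p + ‖∇ η x‖ ^ p) with hJ
  have hcut : ∀ x, 0 ≤ η x ^ p + ‖∇ η x‖ ^ p := fun x =>
    add_nonneg (Real.rpow_nonneg (hη0 x) _) (Real.rpow_nonneg (norm_nonneg _) _)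
  -- Truncation at level `n`. At each `x` the sequence is constant once `n ≥ |v x|`, so Fatou
  -- recovers the untruncated power.
  set F : ℕ → EuclideanSpace ℝ (Fin N) → ℝ≥0∞ := fun n x =>
    ENNReal.ofReal ((η x * (|v x| * truncPow n β (v x))) ^ q) with hF
  have hFm : ∀ n, AEMeasurable (F n) volume := fun n =>
    ((hη.continuous.measurable.aemeasurable.mul
      ((continuous_abs.mul (continuous_truncPow hβ)).measurable.comp_aemeasurable
        hvm.aemeasurable)).pow_const q).ennreal_ofReal
  have hbound : ∀ n : ℕ, ∫⁻ x, F n x ≤ (ENNReal.ofReal (c ^ p * C) * J) ^ (q / p) := by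
    intro n
    obtain ⟨iB, iW, hle⟩ := hC v H G hsol η hη hηs hη0 hbd n (Nat.cast_nonneg n)
    set I := ∫ x, |η x * truncPrim n β (v x)| ^ q with hI
    set B := ∫ x, |truncPrim n β (v x)| ^ p * (η x ^ p + ‖∇ η x‖ ^ p) with hB
    have hI0 : 0 ≤ I := integral_nonneg fun x => by positivity
    have hB0 : 0 ≤ B := integral_nonneg fun x => mul_nonneg (by positivity) (hcut x)
    have hIB : I ≤ (C * B) ^ (q / p) := by
      have := Real.rpow_le_rpow (Real.rpow_nonneg hI0 _) hle (by positivity : 0 ≤ q / p)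
      rwa [← Real.rpow_mul hI0, div_mul_div_cancel₀ hq0.ne', div_self hp0.ne', Real.rpow_one]
        at this
    have hFI : ∫⁻ x, F n x ≤ ENNReal.ofReal (c ^ q * I) := by
      rw [hI, ← integral_const_mul, ofReal_integral_eq_lintegral_ofReal (iW.const_mul _)
        (Eventually.of_forall fun x => by positivity)]
      refine lintegral_mono fun x => ENNReal.ofReal_le_ofReal ?_
      have h0 := truncPow_nonneg (β := β) (Nat.cast_nonneg (α := ℝ) n) (v x)
      rw [← Real.mul_rpow hc0.le (abs_nonneg _)]
      refine Real.rpow_le_rpow (mul_nonneg (hη0 x) (by positivity)) ?_ hq0.le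
      rw [abs_mul, abs_of_nonneg (hη0 x)]
      calc η x * (|v x| * truncPow n β (v x)) ≤ η x * (c * |truncPrim n β (v x)|) :=
            mul_le_mul_of_nonneg_left (abs_mul_truncPow_le (Nat.cast_nonneg n) hβ _) (hη0 x)
        _ = c * (η x * |truncPrim n β (v x)|) := by ring
    have hBJ : ENNReal.ofReal B ≤ J := by
      rw [hB, ofReal_integral_eq_lintegral_ofReal iB
        (Eventually.of_forall fun x => mul_nonneg (by positivity) (hcut x))]
      refine lintegral_mono fun x => ?_
      rw [ENNReal.ofReal_mul (by positivity)]
      refine mul_le_mul_left ?_ _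
      rw [Real.enorm_eq_ofReal_abs, ENNReal.ofReal_rpow_of_nonneg (abs_nonneg _) (by positivity)]
      refine ENNReal.ofReal_le_ofReal ?_
      rw [mul_comm p, Real.rpow_mul (abs_nonneg _)]
      refine Real.rpow_le_rpow (abs_nonneg _) ?_ hp0.le
      rw [Real.rpow_add_of_nonneg (abs_nonneg _) zero_le_one hβ, Real.rpow_one]
      exact (abs_truncPrim_le (Nat.cast_nonneg n) hβ _).trans (mul_le_mul_of_nonneg_left
        (truncPow_le_rpow_abs (Nat.cast_nonneg n) hβ _) (abs_nonneg _))
    have hcq : c ^ q * (C * B) ^ (q / p) = (c ^ p * C * B) ^ (q / p) := by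
      rw [mul_assoc, Real.mul_rpow (x := c ^ p) (by positivity) (by positivity), ← Real.rpow_mul hc0.le,
        mul_div_cancel₀ _ hp0.ne']
    calc ∫⁻ x, F n x ≤ ENNReal.ofReal (c ^ q * I) := hFI
      _ ≤ ENNReal.ofReal ((c ^ p * C * B) ^ (q / p)) := by
          rw [← hcq]
          exact ENNReal.ofReal_le_ofReal (mul_le_mul_of_nonneg_left hIB (by positivity))
      _ = (ENNReal.ofReal (c ^ p * C) * ENNReal.ofReal B) ^ (q / p) := by
          rw [← ENNReal.ofReal_mul (by positivity),
            ENNReal.ofReal_rpow_of_nonneg (by positivity) (by positivity)]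
      _ ≤ _ := by gcongr
  have hlim : ∀ x, liminf (fun n => F n x) atTop =
      (ENNReal.ofReal (η x) * ‖v x‖ₑ ^ (1 + β)) ^ q := by
    intro x
    refine Tendsto.liminf_eq (tendsto_const_nhds.congr' ?_)
    filter_upwards [eventually_ge_atTop ⌈|v x|⌉₊] with n hn
    have hvn : |v x| ≤ n := (Nat.le_ceil _).trans (by exact_mod_cast hn)
    have hpow : |v x| * |v x| ^ β = |v x| ^ (1 + β) := by
      rw [Real.rpow_add_of_nonneg (abs_nonneg _) zero_le_one hβ, Real.rpow_one]
    simp only [hF]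
    rw [truncPow_of_abs_le hvn, hpow, Real.enorm_eq_ofReal_abs,
      ENNReal.ofReal_rpow_of_nonneg (abs_nonneg _) (by positivity), ← ENNReal.ofReal_mul (hη0 x),
      ENNReal.ofReal_rpow_of_nonneg (mul_nonneg (hη0 x) (by positivity)) hq0.le]
  calc ∫⁻ x, (ENNReal.ofReal (η x) * ‖v x‖ₑ ^ (1 + β)) ^ q
      = ∫⁻ x, liminf (fun n => F n x) atTop := lintegral_congr fun x => (hlim x).symm
    _ ≤ liminf (fun n => ∫⁻ x, F n x) atTop := lintegral_liminf_le' hFm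
    _ ≤ liminf (fun _ : ℕ => (ENNReal.ofReal (c ^ p * C) * J) ^ (q / p)) atTop :=
        liminf_le_liminf (Eventually.of_forall hbound)
    _ = _ := liminf_const _

lemma memLp_ofReal_iff {α : Type*} {m : MeasurableSpace α} {μ : Measure α} {v : α → ℝ} {s : ℝ}
    (hs : 0 < s) :
    MemLp v (ENNReal.ofReal s) μ ↔ AEStronglyMeasurable v μ ∧ ∫⁻ x, ‖v x‖ₑ ^ s ∂μ < ⊤ := by
  rw [MemLp, eLpNorm_lt_top_iff_lintegral_rpow_enorm_lt_top (by simpa using hs)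
    ENNReal.ofReal_ne_top, ENNReal.toReal_ofReal hs.le]

variable {v H : EuclideanSpace ℝ (Fin N) → ℝ}
  {G : EuclideanSpace ℝ (Fin N) → EuclideanSpace ℝ (Fin N)}

lemma exists_cutoff_energy_bound {η : EuclideanSpace ℝ (Fin N) → ℝ} (hp : 0 < p)
    (hη : ContDiff ℝ 1 η) (hηs : HasCompactSupport η) (hη0 : ∀ x, 0 ≤ η x) :
    ∃ D : ℝ, ∀ x, η x ^ p + ‖∇ η x‖ ^ p ≤ D := by
  obtain ⟨C, hC⟩ := hηs.exists_bound_of_continuous hη.continuous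
  obtain ⟨D, hD⟩ := (hηs.fderiv ℝ).exists_bound_of_continuous (hη.continuous_fderiv one_ne_zero)
  refine ⟨C ^ p + D ^ p, fun x => add_le_add ?_ ?_⟩
  · exact Real.rpow_le_rpow (hη0 x) ((le_abs_self _).trans (hC x)) hp.le
  · rw [norm_gradient_eq]
    exact Real.rpow_le_rpow (norm_nonneg _) (hD x) hp.le

/-- Local gain of integrability by the factor `q / p`. -/
lemma IsFiniteEnergySolution.memLpLoc_mul (hp : 1 < p) (hpN : p < (N : ℝ)) (hq : 1 < q)
    (hpq : q⁻¹ = p⁻¹ - (N : ℝ)⁻¹) (hsol : IsFiniteEnergySolution p q v G H)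
    (hbd : ∀ R : ℝ, 0 < R → ∃ M : ℝ, 0 ≤ M ∧ ∃ a : EuclideanSpace ℝ (Fin N) → ℝ,
        MemLpLoc a (ENNReal.ofReal ((N : ℝ) / p)) ∧
        ∀ᵐ x : EuclideanSpace ℝ (Fin N), x ∈ Metric.ball 0 R →
          |H x| ≤ (M + a x) * |v x| ^ (p - 1))
    (hβ : 0 ≤ β) (hv : MemLpLoc v (ENNReal.ofReal (p * (1 + β)))) :
    MemLpLoc v (ENNReal.ofReal (q * (1 + β))) := by
  intro K hK
  have hp0 : 0 < p := by linarith
  have hq0 : 0 < q := by linarith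
  obtain ⟨η, hη, hηs, hη0, hη1⟩ := exists_cutoff_eq_one hK
  obtain ⟨R, hR0, hR⟩ := hηs.isCompact.isBounded.subset_ball_lt 0 0
  obtain ⟨M, hM, a, ha, hab⟩ := hbd R hR0
  -- The estimate asks for a global potential but uses the growth bound only where `η ≠ 0`, so `a`
  -- may be cut off outside a ball containing the support of `η`.
  have ha' : MemLp ((Metric.closedBall 0 R).indicator a) (ENNReal.ofReal ((N : ℝ) / p)) volume :=
    (memLp_indicator_iff_restrict measurableSet_closedBall).2 (ha _ (isCompact_closedBall 0 R))
  obtain ⟨C, hC, hest⟩ := exists_lintegral_cutoff_le N hp hpN hq hpq hβ hM ha'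
  have h1 := hest v H G hsol η hη hηs hη0 (by
    filter_upwards [hab] with x hx hηx
    have hxR : x ∈ Metric.ball (0 : EuclideanSpace ℝ (Fin N)) R := hR (subset_tsupport _ hηx)
    rw [Set.indicator_of_mem (Metric.ball_subset_closedBall hxR)]
    exact hx hxR)
  rw [memLp_ofReal_iff (by positivity)]
  refine ⟨(hv K hK).1, ?_⟩
  obtain ⟨D, hD⟩ := exists_cutoff_energy_bound hp0 hη hηs hη0
  have hfin : ∫⁻ x, ‖v x‖ₑ ^ (p * (1 + β)) * ENNReal.ofReal (η x ^ p + ‖∇ η x‖ ^ p) < ⊤ := by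
    have h2 := ((memLp_ofReal_iff (by positivity)).1 (hv _ hηs.isCompact)).2
    calc _ = ∫⁻ x in tsupport η,
          ‖v x‖ₑ ^ (p * (1 + β)) * ENNReal.ofReal (η x ^ p + ‖∇ η x‖ ^ p) := by
          refine (setLIntegral_eq_of_support_subset fun x hx => ?_).symm
          by_contra h
          refine hx ?_
          simp [image_eq_zero_of_notMem_tsupport h, gradient_eq_zero_of_notMem_tsupport h,
            Real.zero_rpow hp0.ne']
      _ ≤ ∫⁻ x in tsupport η, ‖v x‖ₑ ^ (p * (1 + β)) * ENNReal.ofReal D := by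
          gcongr with x
          exact hD x
      _ = (∫⁻ x in tsupport η, ‖v x‖ₑ ^ (p * (1 + β))) * ENNReal.ofReal D :=
          lintegral_mul_const' _ _ ENNReal.ofReal_ne_top
      _ < ⊤ := ENNReal.mul_lt_top h2 ENNReal.ofReal_lt_top
  calc ∫⁻ x in K, ‖v x‖ₑ ^ (q * (1 + β))
      = ∫⁻ x in K, (ENNReal.ofReal (η x) * ‖v x‖ₑ ^ (1 + β)) ^ q := by
        refine setLIntegral_congr_fun hK.measurableSet fun x hx => ?_
        rw [hη1 x hx, ENNReal.ofReal_one, one_mul, ← ENNReal.rpow_mul, mul_comm q]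
    _ ≤ ∫⁻ x, (ENNReal.ofReal (η x) * ‖v x‖ₑ ^ (1 + β)) ^ q := setLIntegral_le_lintegral _ _
    _ ≤ _ := h1
    _ < ⊤ := ENNReal.rpow_lt_top_of_nonneg (by positivity) (ENNReal.mul_lt_top hC.lt_top hfin).ne

variable (N p) in
/-- Cutoffs exhausting the space, with uniformly bounded gradients. -/
lemma exists_exhausting_cutoffs (hp : 0 < p) :
    ∃ (η : ℕ → EuclideanSpace ℝ (Fin N) → ℝ) (D : ℝ), (∀ n, ContDiff ℝ 1 (η n)) ∧
      (∀ n, HasCompactSupport (η n)) ∧ (∀ n x, 0 ≤ η n x) ∧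
      (∀ x, ∀ᶠ n in atTop, η n x = 1) ∧ ∀ n x, η n x ^ p + ‖∇ (η n) x‖ ^ p ≤ D := by
  let φ : ContDiffBump (0 : EuclideanSpace ℝ (Fin N)) := ⟨1, 2, by norm_num, by norm_num⟩
  have hφ : ContDiff ℝ 1 φ := φ.contDiff
  obtain ⟨C, hC⟩ := (φ.hasCompactSupport.fderiv ℝ).exists_bound_of_continuous
    (hφ.continuous_fderiv one_ne_zero)
  set r : ℕ → ℝ := fun n => ((n : ℝ) + 1)⁻¹ with hr
  have hr0 : ∀ n, 0 < r n := fun n => by positivity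
  have hr1 : ∀ n, r n ≤ 1 := fun n => inv_le_one_of_one_le₀ (by simp)
  refine ⟨fun n x => φ (r n • x), 1 + C ^ p, fun n => hφ.comp (contDiff_const_smul _),
    fun n => ?_, fun n x => φ.nonneg, fun x => ?_, fun n x => add_le_add ?_ ?_⟩
  · exact φ.hasCompactSupport.comp_homeomorph (Homeomorph.smulOfNeZero (r n) (hr0 n).ne')
  · filter_upwards [eventually_ge_atTop ⌈‖x‖⌉₊] with n hn
    have hxn : ‖x‖ ≤ n := (Nat.le_ceil _).trans (by exact_mod_cast hn)
    refine φ.one_of_mem_closedBall ?_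
    rw [mem_closedBall_zero_iff, norm_smul, Real.norm_of_nonneg (hr0 n).le]
    change r n * ‖x‖ ≤ 1
    rw [hr, inv_mul_le_iff₀ (by positivity)]
    linarith
  · exact Real.rpow_le_one φ.nonneg φ.le_one hp.le
  · rw [norm_gradient_eq]
    refine Real.rpow_le_rpow (norm_nonneg _) ?_ hp.le
    have h1 : HasFDerivAt (fun x => φ (r n • x)) ((fderiv ℝ φ (r n • x)).comp
        (r n • ContinuousLinearMap.id ℝ (EuclideanSpace ℝ (Fin N)))) x :=
      (hφ.differentiable one_ne_zero (r n • x)).hasFDerivAt.comp x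
        ((hasFDerivAt_id x).const_smul (r n))
    rw [h1.fderiv, ContinuousLinearMap.comp_smul, ContinuousLinearMap.comp_id, norm_smul,
      Real.norm_of_nonneg (hr0 n).le]
    calc r n * ‖fderiv ℝ φ (r n • x)‖ ≤ 1 * C :=
          mul_le_mul (hr1 n) (hC _) (norm_nonneg _) zero_le_one
      _ = C := one_mul C

/-- Global gain of integrability by the factor `q / p`. -/
lemma IsFiniteEnergySolution.memLp_mul (hp : 1 < p) (hpN : p < (N : ℝ)) (hq : 1 < q)
    (hpq : q⁻¹ = p⁻¹ - (N : ℝ)⁻¹) (hsol : IsFiniteEnergySolution p q v G H) (hM : 0 ≤ M)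
    (ha : MemLp a (ENNReal.ofReal ((N : ℝ) / p)) volume)
    (hbd : ∀ᵐ x, |H x| ≤ (M + a x) * |v x| ^ (p - 1))
    (hβ : 0 ≤ β) (hv : MemLp v (ENNReal.ofReal (p * (1 + β))) volume) :
    MemLp v (ENNReal.ofReal (q * (1 + β))) volume := by
  have hp0 : 0 < p := by linarith
  have hq0 : 0 < q := by linarith
  obtain ⟨C, hC, hest⟩ := exists_lintegral_cutoff_le N hp hpN hq hpq hβ hM ha
  obtain ⟨η, D, hη, hηs, hη0, hη1, hD⟩ := exists_exhausting_cutoffs N p hp0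
  -- Independent of `n`: `C` depends on the global `a` but not on the cutoff, and `D` bounds all
  -- cutoffs and their gradients.
  set B : ℝ≥0∞ := (C * ((∫⁻ x, ‖v x‖ₑ ^ (p * (1 + β))) * ENNReal.ofReal D)) ^ (q / p) with hB
  have hbound : ∀ n, ∫⁻ x, (ENNReal.ofReal (η n x) * ‖v x‖ₑ ^ (1 + β)) ^ q ≤ B := by
    intro n
    refine (hest v H G hsol (η n) (hη n) (hηs n) (hη0 n)
      (hbd.mono fun x hx _ => hx)).trans ?_
    rw [hB, ← lintegral_mul_const' _ _ ENNReal.ofReal_ne_top]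
    gcongr with x
    exact hD n x
  have hvm := hv.1
  rw [memLp_ofReal_iff (by positivity)] at hv ⊢
  refine ⟨hvm, lt_of_le_of_lt ?_ (ENNReal.rpow_lt_top_of_nonneg (by positivity)
    (ENNReal.mul_lt_top hC.lt_top (ENNReal.mul_lt_top hv.2 ENNReal.ofReal_lt_top)).ne : B < ⊤)⟩
  calc ∫⁻ x, ‖v x‖ₑ ^ (q * (1 + β))
      = ∫⁻ x, liminf (fun n => (ENNReal.ofReal (η n x) * ‖v x‖ₑ ^ (1 + β)) ^ q) atTop := by
        refine lintegral_congr fun x => (Tendsto.liminf_eq (tendsto_const_nhds.congr' ?_)).symm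
        filter_upwards [hη1 x] with n hn
        rw [hn, ENNReal.ofReal_one, one_mul, ← ENNReal.rpow_mul, mul_comm q]
    _ ≤ liminf (fun n => ∫⁻ x, (ENNReal.ofReal (η n x) * ‖v x‖ₑ ^ (1 + β)) ^ q) atTop := by
        refine lintegral_liminf_le' fun n => ?_
        exact (((hη n).continuous.measurable.ennreal_ofReal.aemeasurable).mul
          (hvm.enorm.pow_const _)).pow_const q
    _ ≤ liminf (fun _ : ℕ => B) atTop := liminf_le_liminf (Eventually.of_forall hbound)
    _ = B := liminf_const B

end Moser

/-! ### Iterating the gain and reducing the theorem to it. -/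

section Iteration

open scoped ENNReal

variable {N : ℕ} {p q : ℝ} {v H : EuclideanSpace ℝ (Fin N) → ℝ}
  {G : EuclideanSpace ℝ (Fin N) → EuclideanSpace ℝ (Fin N)}

/-- Pointwise `|u|^s ≤ |u|^r + |u|^t`, according to whether `|u| ≤ 1`. -/
lemma memLp_of_exponent_between {α : Type*} {m : MeasurableSpace α} {μ : Measure α} {u : α → ℝ}
    {r s t : ℝ} (hr : 0 < r) (hrs : r ≤ s) (hst : s ≤ t) (hur : MemLp u (ENNReal.ofReal r) μ)
    (hut : MemLp u (ENNReal.ofReal t) μ) : MemLp u (ENNReal.ofReal s) μ := by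
  rw [memLp_ofReal_iff (by linarith)] at hur hut ⊢
  refine ⟨hur.1, ?_⟩
  calc ∫⁻ x, ‖u x‖ₑ ^ s ∂μ ≤ ∫⁻ x, (‖u x‖ₑ ^ r + ‖u x‖ₑ ^ t) ∂μ := by
        refine lintegral_mono fun x => ?_
        rcases le_total ‖u x‖ₑ 1 with h | h
        · exact (ENNReal.rpow_le_rpow_of_exponent_ge h hrs).trans le_self_add
        · exact (ENNReal.rpow_le_rpow_of_exponent_le h hst).trans le_add_self
    _ = ∫⁻ x, ‖u x‖ₑ ^ r ∂μ + ∫⁻ x, ‖u x‖ₑ ^ t ∂μ :=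
        lintegral_add_left' (hur.1.enorm.pow_const r) _
    _ < ⊤ := ENNReal.add_lt_top.2 ⟨hur.2, hut.2⟩

/-- If integrability improves by the factor `q / p > 1`, all finite exponents are reached. -/
lemma exists_exponent_ge_of_gain {P : ℝ → Prop} (hp : 0 < p) (hpq : p < q) (hP : P p)
    (hgain : ∀ β, 0 ≤ β → P (p * (1 + β)) → P (q * (1 + β))) (s : ℝ) : ∃ t, s ≤ t ∧ P t := by
  have hχ : 1 < q / p := (one_lt_div hp).2 hpq
  have hall : ∀ n : ℕ, P (p * (q / p) ^ n) := by
    intro n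
    induction n with
    | zero => simpa using hP
    | succ n ih =>
      -- The choice `β = (q/p)^n - 1` makes `p (1 + β)` the current exponent and `q (1 + β)` the
      -- next one.
      have h1 : 0 ≤ (q / p) ^ n - 1 := by linarith [one_le_pow₀ hχ.le (n := n)]
      have h2 := hgain _ h1 (by simpa using ih)
      have h3 : q * (1 + ((q / p) ^ n - 1)) = p * (q / p) ^ (n + 1) := by
        rw [pow_succ]
        field_simp
        ring
      rwa [h3] at h2
  obtain ⟨n, hn⟩ := pow_unbounded_of_one_lt (s / p) hχ
  exact ⟨_, by rw [div_lt_iff₀ hp] at hn; linarith, hall n⟩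

/-- Local Sobolev embedding puts `v` in `L^q` locally, and the growth bound then puts `h(x, v)` in
the dual space. The Carathéodory condition enters only for measurability of `h(x, v)`. -/
lemma IsWeakSolution.exists_isFiniteEnergySolution (hp : 1 < p) (hpN : p < (N : ℝ)) (hq : 1 < q)
    (hpq : q⁻¹ = p⁻¹ - (N : ℝ)⁻¹) {h : EuclideanSpace ℝ (Fin N) → ℝ → ℝ}
    (hh : IsCaratheodoryFun h) (hv : MemW1pLoc p v) (hsol : IsWeakSolution p h v)
    (hbd : ∀ R : ℝ, 0 < R → ∃ M : ℝ, 0 ≤ M ∧ ∃ a : EuclideanSpace ℝ (Fin N) → ℝ,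
        MemLpLoc a (ENNReal.ofReal ((N : ℝ) / p)) ∧
        ∀ᵐ x : EuclideanSpace ℝ (Fin N), x ∈ Metric.ball 0 R →
          |h x (v x)| ≤ (M + a x) * |v x| ^ (p - 1)) :
    ∃ G, IsFiniteEnergySolution p q v G fun x => h x (v x) := by
  obtain ⟨hvp, G', hw', hG'⟩ := hv
  obtain ⟨G, hw, hweak⟩ := hsol
  have hG : MemLpLoc G (ENNReal.ofReal p) := fun K hK =>
    (memLp_congr_ae (ae_restrict_of_ae (hw.ae_unique hw'))).2 (hG' K hK)
  have hN : 0 < N := by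
    have : (0 : ℝ) < N := by linarith
    exact_mod_cast this
  have hvq := memLpLoc_of_hasWeakGradient hp.le hN (by linarith) hpq hw hvp hG
  refine ⟨G, hw, hvp, hG, fun K hK => ?_, fun φ hφ hφs => ?_⟩
  · obtain ⟨R, hR0, hR⟩ := hK.isBounded.subset_ball_lt 0 0
    obtain ⟨M, -, a, ha, hab⟩ := hbd R hR0
    refine memLp_restrict_of_le_mul_rpow hp hpN hq hpq hK (ha K hK) (hvq K hK)
      (hh.aemeasurable_comp hw.1.aestronglyMeasurable.aemeasurable).aestronglyMeasurable.restrict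
      (M := M) ?_
    filter_upwards [ae_restrict_of_ae hab, ae_restrict_mem hK.measurableSet] with x hx hxK
    exact hx (hR hxK)
  · rw [← hweak φ hφ hφs]
    refine integral_congr_ae (Eventually.of_forall fun x => ?_)
    simp

end Iteration

theorem lemma3p5 (N : ℕ) (p : ℝ) (hp : 1 < p) (hpN : p < (N : ℝ))
    (h : EuclideanSpace ℝ (Fin N) → ℝ → ℝ) (hh : IsCaratheodoryFun h) :
    (∀ v : EuclideanSpace ℝ (Fin N) → ℝ, MemW1p p v → IsWeakSolution p h v →
      (∃ M : ℝ, 0 ≤ M ∧ ∃ a : EuclideanSpace ℝ (Fin N) → ℝ,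
        MemLp a (ENNReal.ofReal ((N : ℝ) / p)) volume ∧
        ∀ᵐ x : EuclideanSpace ℝ (Fin N), |h x (v x)| ≤ (M + a x) * |v x| ^ (p - 1)) →
      ∀ s : ℝ, p ≤ s → MemLp v (ENNReal.ofReal s) volume) ∧
    (∀ v : EuclideanSpace ℝ (Fin N) → ℝ, MemW1pLoc p v → IsWeakSolution p h v →
      (∀ R : ℝ, 0 < R → ∃ M : ℝ, 0 ≤ M ∧ ∃ a : EuclideanSpace ℝ (Fin N) → ℝ,
        MemLpLoc a (ENNReal.ofReal ((N : ℝ) / p)) ∧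
        ∀ᵐ x : EuclideanSpace ℝ (Fin N), x ∈ Metric.ball 0 R →
          |h x (v x)| ≤ (M + a x) * |v x| ^ (p - 1)) →
      ∀ s : ℝ, p ≤ s → MemLpLoc v (ENNReal.ofReal s)) := by
  have hp0 : 0 < p := by linarith
  have hN0 : (0 : ℝ) < N := by linarith
  have hd : 0 < p⁻¹ - (N : ℝ)⁻¹ := sub_pos.2 (inv_strictAnti₀ hp0 hpN)
  -- The Sobolev exponent `N p / (N - p)`, introduced only through its reciprocal.
  obtain ⟨q, hpq⟩ : ∃ q : ℝ, q⁻¹ = p⁻¹ - (N : ℝ)⁻¹ := ⟨_, inv_inv _⟩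
  have hq0 : 0 < q := inv_pos.1 (hpq ▸ hd)
  have hpltq : p < q := by
    refine (inv_lt_inv₀ hq0 hp0).1 ?_
    rw [hpq]
    linarith [inv_pos.2 hN0]
  have hq : 1 < q := hp.trans hpltq
  constructor
  · rintro v ⟨hv, G', hw', hG'⟩ hsol ⟨M, hM, a, ha, hab⟩ s hs
    obtain ⟨G, hG⟩ := hsol.exists_isFiniteEnergySolution hp hpN hq hpq hh
      ⟨fun K _ => hv.restrict K, G', hw', fun K _ => hG'.restrict K⟩
      fun R _ => ⟨M, hM, a, fun K _ => ha.restrict K, hab.mono fun x hx _ => hx⟩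
    obtain ⟨t, hst, ht⟩ := exists_exponent_ge_of_gain
      (P := fun t => MemLp v (ENNReal.ofReal t) volume) hp0 hpltq hv
      (fun β hβ hvβ => hG.memLp_mul hp hpN hq hpq hM ha hab hβ hvβ) s
    exact memLp_of_exponent_between hp0 hs hst hv ht
  · intro v hv hsol hbd s hs
    obtain ⟨G, hG⟩ := hsol.exists_isFiniteEnergySolution hp hpN hq hpq hh hv hbd
    obtain ⟨t, hst, ht⟩ := exists_exponent_ge_of_gain
      (P := fun t => MemLpLoc v (ENNReal.ofReal t)) hp0 hpltq hv.1
      (fun β hβ hvβ => hG.memLpLoc_mul hp hpN hq hpq hbd hβ hvβ) s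
    exact fun K hK => memLp_of_exponent_between hp0 hs hst (hv.1 K hK) (ht K hK)
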